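/- Conventions. In a group, $a^g=g^{-1}ag$, $C(a)$ is the centraliser of $a$, and "$a\in C(b)$" stands for the formula $ab=ba$. A group $\Gamma$ is \emph{inner ultrahomogeneous} if for every isomorphism $p\colon A\to B$ between finitely generated subgroups of $\Gamma$ there is $g\in\Gamma$ with $a^g=p(a)$ for all $a\in A$. It has \emph{infinite exponent} if there is no integer $m>0$ with $g^m=1$ for all $g\in\Gamma$. A formula $\varphi(\bar x;\bar y)$ in the language of groups (with the indicated partition of its free variables) has, in $\Gamma$, - the \emph{order property} if in some model $N$ of $\mathrm{Th}(\Gamma)$ there are tuples $(\bar a_i)_{i\in\mathbf N}$, $(\bar b_j)_{j\in\mathbf N}$ with $N\models\varphi(\bar a_i;\bar b_j)\iff i<j$; - the \emph{independence property} if in some model $N$ of $\mathrm{Th}(\Gamma)$ there are tuples $(\bar a_i)_{i\in\mathbf N}$, $(\bar b_S)_{S\subseteq\mathbf N}$ with $N\models\varphi(\bar a_i;\bar b_S)\iff i\in S$; - the \emph{$n$-independence property}, where $\bar x=(\bar x_1,\dots,\bar x_n)$, if in some model $N$ of $\mathrm{Th}(\Gamma)$ there are tuples $(\bar a_{j,i})_{1\le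 j\le n,\,i\in\mathbf N}$, $(\bar b_S)_{S\subseteq\mathbf N^n}$ with $N\models\varphi(\bar a_{1,i_1},\dots,\bar a_{n,i_n};\bar b_S)\iff(i_1,\dots,i_n)\in S$; - the \emph{strict order property} if in some model $N$ of $\mathrm{Th}(\Gamma)$ there are tuples $(\bar b_i)_{i\in\mathbf N}$ with $\varphi(N;\bar b_i)\subsetneq\varphi(N;\bar b_j)$ for all $i<j$; - the \emph{tree property of the second kind} ($\mathrm{TP}_2$) if in some model $N$ of $\mathrm{Th}(\Gamma)$ there are tuples $(\bar b_{i,j})_{i,j\in\mathbf N}$ and $k\in\mathbf N$ such that for each $i$ no $k$ of the formulas $\varphi(\bar x;\bar b_{i,j})$, $j\in\mathbf N$ (with distinct $j$), are simultaneously satisfied by a tuple of $N$, while for each $f\colon\mathbf N\to\mathbf N$ some tuple of $N$ satisfies all of the formulas $\varphi(\bar x;\bar b_{i,f(i)})$, $i\in\mathbf N$. Theorem. Let $\Gamma$ be an inner ultrahomogeneous group of infinite exponent. Then: 1. the formula $xy=yx$ (in the variables $x;y$) has the independence property, and also the order property; 2. for each $n\in\mathbf N$, the formula $\varphi(x_1,\dots,x_n;y_1,y_2)$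 given by $y_1^{x_1x_2\cdots x_n}\in C(y_2)$ has the $n$-independence property, with each $\bar x_j$ the single variable $x_j$ (for $n=0$ the empty product is $1$ and $\mathbf N^0$ is a point); 3. the formula $C(x)\subseteq C(y)$, i.e. $\forall z\,(zx=xz\to zy=yz)$ (in the variables $x;y$), has the strict order property; 4. the formula $x\in C(y_2)\setminus C(y_1)$ (in the variables $x;y_1,y_2$) has the tree property of the second kind. -/

import Mathlib

namespace Untame

open FirstOrder FirstOrder.Language

/-! ### Inner ultrahomogeneous groups -/

/-- Conjugation as a right action: `a ^ g = g⁻¹ a g`. -/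
def conjBy {G : Type*} [Group G] (a g : G) : G := g⁻¹ * a * g

/-- A group is inner ultrahomogeneous if every finite partial automorphism, i.e. every isomorphism
between two finitely generated subgroups, is the restriction of an inner automorphism. -/
def InnerUltrahomogeneous (G : Type*) [Group G] : Prop :=
  ∀ A B : Subgroup G, A.FG → B.FG → ∀ p : A ≃* B, ∃ g : G, ∀ a : A, conjBy (a : G) g = p a

/-! ### The first-order language of groups -/

/-- The function symbols of the language of groups. -/
inductive GroupFunc : ℕ → Type
  | mul : GroupFunc 2
  | inv : GroupFunc 1
  | one : GroupFunc 0

/-- The language of groups, with symbols for product, inverse and identity. -/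
def groupLang : Language :=
  { Functions := GroupFunc
    Relations := fun _ => Empty }

/-- The symbol for the product. -/
abbrev mulSymb : groupLang.Functions 2 := GroupFunc.mul

/-- The symbol for the inverse. -/
abbrev invSymb : groupLang.Functions 1 := GroupFunc.inv

/-- The symbol for the identity element. -/
abbrev oneSymb : groupLang.Functions 0 := GroupFunc.one

/-- Every group is a structure in the language of groups. -/
instance groupStructure (G : Type*) [Group G] : groupLang.Structure G where
  funMap {_} f :=
    match f with
    | GroupFunc.mul => fun v => v 0 * v 1
    | GroupFunc.inv => fun v => (v 0)⁻¹
    | GroupFunc.one => fun _ => 1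
  RelMap {_} r := Empty.elim r

instance termMul (α : Type*) : Mul (groupLang.Term α) :=
  ⟨fun s t => mulSymb.apply₂ s t⟩

instance termInv (α : Type*) : Inv (groupLang.Term α) :=
  ⟨fun t => invSymb.apply₁ t⟩

instance termOne (α : Type*) : One (groupLang.Term α) :=
  ⟨Constants.term oneSymb⟩

/-! ### Dividing lines

Let `M` be an `L`-structure and `φ(x; y)` an `L`-formula whose free variables are partitioned into
the tuples `x` (indexed by `α`) and `y` (indexed by `β`). As usual, `φ` has one of the properties
below (in `M`, or equivalently modulo the complete theory of `M`) if some model `N` of the complete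
theory of `M` contains the relevant infinite configuration. Taking `N` in the universe of `M` is no
restriction, since an ultrapower of `M` over `ℕ` is then enough. -/

section DividingLines

universe w

variable {L : Language} {α β : Type}

/-- `φ(a; b)` holds in `N`. -/
def Holds (N : Type*) [L.Structure N] (φ : L.Formula (α ⊕ β)) (a : α → N) (b : β → N) : Prop :=
  φ.Realize (Sum.elim a b)

/-- The order property. -/
def HasOP (M : Type w) [L.Structure M] (φ : L.Formula (α ⊕ β)) : Prop :=
  ∃ (N : Type w) (_ : L.Structure N), L.ElementarilyEquivalent M N ∧
    ∃ (a : ℕ → α → N) (b : ℕ → β → N), ∀ i j, Holds N φ (a i) (b j) ↔ i < j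

/-- The independence property. -/
def HasIP (M : Type w) [L.Structure M] (φ : L.Formula (α ⊕ β)) : Prop :=
  ∃ (N : Type w) (_ : L.Structure N), L.ElementarilyEquivalent M N ∧
    ∃ (a : ℕ → α → N) (b : Set ℕ → β → N), ∀ i S, Holds N φ (a i) (b S) ↔ i ∈ S

/-- The `n`-independence property of a formula `φ(x₁, …, xₙ; y)`, where the tuple `xⱼ` is indexed
by `γ j`: there are elements `a j i` (for `j < n` and `i ∈ ℕ`) such that every subset of `ℕⁿ` is
cut out by `φ` on the grid of the `a j i`, for some value of `y`. -/
def HasIPn (n : ℕ) {γ : Fin n → Type} (M : Type w) [L.Structure M]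
    (φ : L.Formula ((Σ j, γ j) ⊕ β)) : Prop :=
  ∃ (N : Type w) (_ : L.Structure N), L.ElementarilyEquivalent M N ∧
    ∃ (a : ∀ j : Fin n, ℕ → γ j → N) (b : Set (Fin n → ℕ) → β → N),
      ∀ (i : Fin n → ℕ) (S : Set (Fin n → ℕ)),
        Holds N φ (fun v : Σ j, γ j => a v.1 (i v.1) v.2) (b S) ↔ i ∈ S

/-- The strict order property: an infinite strictly increasing chain of sets `φ(N; b i)`. -/
def HasSOP (M : Type w) [L.Structure M] (φ : L.Formula (α ⊕ β)) : Prop :=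
  ∃ (N : Type w) (_ : L.Structure N), L.ElementarilyEquivalent M N ∧
    ∃ b : ℕ → β → N, ∀ i j, i < j →
      {a : α → N | Holds N φ a (b i)} ⊂ {a : α → N | Holds N φ a (b j)}

/-- The tree property of the second kind: there are an array `b i j` and a number `k` such that
each row `{φ(x; b i j) | j ∈ ℕ}` is `k`-inconsistent, and each path `{φ(x; b i (f i)) | i ∈ ℕ}` is
consistent. -/
def HasTP2 (M : Type w) [L.Structure M] (φ : L.Formula (α ⊕ β)) : Prop :=
  ∃ (N : Type w) (_ : L.Structure N), L.ElementarilyEquivalent M N ∧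
    ∃ (b : ℕ → ℕ → β → N) (k : ℕ),
      (∀ (i : ℕ) (s : Finset ℕ), s.card = k → ¬ ∃ a : α → N, ∀ j ∈ s, Holds N φ a (b i j)) ∧
      (∀ f : ℕ → ℕ, ∃ a : α → N, ∀ i, Holds N φ a (b i (f i)))

end DividingLines

/-! ### The formulas -/

/-- For terms `s` and `t`, the formula `s t = t s`, i.e. `s ∈ C(t)`. -/
def commFormula {α : Type} (s t : groupLang.Term α) : groupLang.Formula α :=
  Term.equal (s * t) (t * s)

/-- The formula `x y = y x` in the variables `x; y`. -/
def commXY : groupLang.Formula (Fin 1 ⊕ Fin 1) :=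
  commFormula (Term.var (Sum.inl 0)) (Term.var (Sum.inr 0))

/-- The formula `y₁ ^ (x₁ x₂ ⋯ xₙ) ∈ C(y₂)` in the variables `x₁, …, xₙ; y₁, y₂`. Here `xⱼ` is a
single variable for each `j`. -/
def conjProdComm (n : ℕ) : groupLang.Formula ((Σ _ : Fin n, Fin 1) ⊕ Fin 2) :=
  let g : groupLang.Term ((Σ _ : Fin n, Fin 1) ⊕ Fin 2) :=
    (List.ofFn fun j : Fin n => Term.var (Sum.inl ⟨j, 0⟩)).prod
  commFormula (g⁻¹ * Term.var (Sum.inr 0) * g) (Term.var (Sum.inr 1))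

/-- The formula `C(x) ⊆ C(y)`, i.e. `∀ z, z x = x z → z y = y z`, in the variables `x; y`. -/
def centralizerLe : groupLang.Formula (Fin 1 ⊕ Fin 1) :=
  let x : groupLang.Term ((Fin 1 ⊕ Fin 1) ⊕ Fin 1) := Term.var (Sum.inl (Sum.inl 0))
  let y : groupLang.Term ((Fin 1 ⊕ Fin 1) ⊕ Fin 1) := Term.var (Sum.inl (Sum.inr 0))
  let z : groupLang.Term ((Fin 1 ⊕ Fin 1) ⊕ Fin 1) := Term.var (Sum.inr 0)
  BoundedFormula.all ((Term.bdEqual (z * x) (x * z)).imp (Term.bdEqual (z * y) (y * z)))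

/-- The formula `x ∈ C(y₂) ∖ C(y₁)` in the variables `x; y₁, y₂`. -/
def centralizerDiff : groupLang.Formula (Fin 1 ⊕ Fin 2) :=
  commFormula (Term.var (Sum.inl 0)) (Term.var (Sum.inr 1)) ⊓
    (commFormula (Term.var (Sum.inl 0)) (Term.var (Sum.inr 0))).not

end Untame

/-! Inner ultrahomogeneity turns every isomorphism between finitely generated subgroups into a
conjugation. The basic object is a homomorphism from `ℤ^m` with kernel `N ℤ^m` (`FreeModulo`; `N =
0` is allowed): each endomorphism of `ℤ^m` that is injective modulo `N` becomes a conjugation. If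
such maps exist in all ranks with `N ≠ 1, 2`, sign changes give the independence property, and
translations of a basis indexed by a grid give the `n`-independence properties. The strict order
property and TP₂ come from independent chains of centralizers of `e i ^ d ^ j`. Since these are only
needed at each finite size, an ultrapower finishes.

If some `a` has infinite order, then `a` is conjugate to each `a ^ p`. Commuting conjugators can be
chosen for distinct primes, and unique factorization makes them a basis of a free abelian group. The
chains come from twisting such a group by an element `s` that inverts a further generator `w`: the
twisted generators do not commute with `w`, but their squares do.

If `G` is torsion, it is enough to find elements of order `q ^ n` for one prime `q` and all `n`: the
multiplier `1 + Q ^ 2` on a free module over `ℤ/Q⁴` yields a free module over `ℤ/Q` of larger rank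
(`FreeModulo.exists_succ`). Some element has order `q ^ 2`. Otherwise all orders are squarefree; an
element of prime order `p` gives one of order divisible by `p - 1`, so only the primes `2, 3, 7, 43`
occur, and the exponent divides `1806`. From order `q ^ 2`, abelian `q`-subgroups are unboundedly
large. In one of maximal order, a transvection `a ↦ a χ(a)` is induced by some `g`, and `(g b) ^ q =
g ^ q N(b)` for a norm `N`; maximality forces the kernel of `N` into the image of `χ`, which a
suitable `χ` violates. Large abelian `q`-subgroups of bounded exponent contain elementary ones of
large rank, and permuting a basis cyclically gives elements of order `q ^ n`. -/

namespace Untame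

/-! ### Partial isomorphisms and free modules over `ℤ/N` -/

/-- In an inner ultrahomogeneous group, a finitely generated graph of a partial isomorphism is
contained in the graph of a conjugation. -/
theorem InnerUltrahomogeneous.exists_conj_of_graph {G : Type*} [Group G]
    (hG : InnerUltrahomogeneous G) (R : Subgroup (G × G)) (hR : R.FG)
    (h₁ : ∀ x, (x, 1) ∈ R → x = 1) (h₂ : ∀ y, (1, y) ∈ R → y = 1) :
    ∃ g : G, ∀ x y, (x, y) ∈ R → g⁻¹ * x * g = y := by
  -- The two hypotheses make both projections of `R` injective, so `R` is the graph of an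
  -- isomorphism between its projections.
  have i₁ : Function.Injective ((MonoidHom.fst G G).comp R.subtype) := by
    rw [injective_iff_map_eq_one]
    rintro ⟨⟨x, y⟩, h⟩ hx
    have hx' : x = 1 := hx
    subst hx'
    simp [h₂ y h]
  have i₂ : Function.Injective ((MonoidHom.snd G G).comp R.subtype) := by
    rw [injective_iff_map_eq_one]
    rintro ⟨⟨x, y⟩, h⟩ hx
    have hx' : y = 1 := hx
    subst hx'
    simp [h₁ x h]
  have : Group.FG R := (Group.fg_iff_subgroup_fg R).2 hR
  have f₁ : ((MonoidHom.fst G G).comp R.subtype).range.FG :=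
    (Group.fg_iff_subgroup_fg _).1 (Group.fg_range _)
  have f₂ : ((MonoidHom.snd G G).comp R.subtype).range.FG :=
    (Group.fg_iff_subgroup_fg _).1 (Group.fg_range _)
  obtain ⟨g, hg⟩ := hG _ _ f₁ f₂
    ((MonoidHom.ofInjective i₁).symm.trans (MonoidHom.ofInjective i₂))
  refine ⟨g, fun x y h => ?_⟩
  have := hg (MonoidHom.ofInjective i₁ ⟨(x, y), h⟩)
  rw [MulEquiv.trans_apply, MulEquiv.symm_apply_apply] at this
  exact this

theorem mul_mem_zpow_form {G : Type*} [Group G] (B : Subgroup G) (g : G)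
    (hg : ∀ b ∈ B, g⁻¹ * b * g ∈ B) (hg' : ∀ b ∈ B, g * b * g⁻¹ ∈ B) {x : G}
    (hx : x ∈ B ⊔ Subgroup.zpowers g) : ∃ b ∈ B, ∃ n : ℤ, x = g ^ n * b := by
  have hle : Subgroup.zpowers g ≤ Subgroup.normalizer (B : Set G) := by
    rw [Subgroup.zpowers_le, Subgroup.mem_normalizer_iff]
    intro b
    refine ⟨hg' b, fun h => ?_⟩
    have := hg _ h
    simpa [mul_assoc] using this
  rw [← SetLike.mem_coe, sup_comm, Subgroup.coe_mul_of_left_le_normalizer_right _ _ hle] at hx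
  obtain ⟨_, ⟨n, rfl⟩, b, hb, rfl⟩ := hx
  exact ⟨b, hb, n, rfl⟩

/-- The homomorphism `E` from a power of `ℤ` has kernel the multiples of `N`. -/
def FreeModulo {G ι : Type*} [Group G] (N : ℕ) (E : Multiplicative (ι → ℤ) →* G) : Prop :=
  ∀ v, E (Multiplicative.ofAdd v) = 1 ↔ ∀ i, (N : ℤ) ∣ v i

/-- The two maps have the same kernel, so `E v ↦ F v` is an isomorphism between their finitely
generated images. -/
theorem FreeModulo.exists_conj {G ι : Type*} [Group G] [Finite ι]
    (hG : InnerUltrahomogeneous G) {N : ℕ} {E F : Multiplicative (ι → ℤ) →* G}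
    (hE : FreeModulo N E) (hF : FreeModulo N F) :
    ∃ g : G, ∀ v, g⁻¹ * E v * g = F v := by
  have : Group.FG (Multiplicative (ι → ℤ)) := inferInstance
  obtain ⟨g, hg⟩ := hG.exists_conj_of_graph (E.prod F).range
    ((Group.fg_iff_subgroup_fg _).1 (Group.fg_range _))
    (by
      rintro x ⟨v, hv⟩
      have h1 : E v = x := congrArg Prod.fst hv
      have h2 : F v = 1 := congrArg Prod.snd hv
      rw [← h1]
      exact (hE v.toAdd).2 ((hF v.toAdd).1 h2))
    (by
      rintro x ⟨v, hv⟩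
      have h1 : E v = 1 := congrArg Prod.fst hv
      have h2 : F v = x := congrArg Prod.snd hv
      rw [← h2]
      exact (hF v.toAdd).2 ((hE v.toAdd).1 h1))
  exact ⟨g, fun v => hg _ _ ⟨v, rfl⟩⟩

/-- A linear endomorphism of `ℤ^ι`, precomposed with `E`. -/
def twist {G ι : Type*} [Group G] (E : Multiplicative (ι → ℤ) →* G)
    (M : (ι → ℤ) →+ (ι → ℤ)) : Multiplicative (ι → ℤ) →* G :=
  E.comp (AddMonoidHom.toMultiplicative M)

@[simp] theorem twist_ofAdd {G ι : Type*} [Group G] (E : Multiplicative (ι → ℤ) →* G)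
    (M : (ι → ℤ) →+ (ι → ℤ)) (v : ι → ℤ) :
    twist E M (Multiplicative.ofAdd v) = E (Multiplicative.ofAdd (M v)) := rfl

/-- Injectivity of `M` modulo `N` is enough, as the image may be a proper subgroup; for `N = 0` this
allows multiplication by any nonzero integer. -/
theorem FreeModulo.exists_conj_linear {G ι : Type*} [Group G] [Finite ι]
    (hG : InnerUltrahomogeneous G) {N : ℕ} {E : Multiplicative (ι → ℤ) →* G}
    (hE : FreeModulo N E) (M : (ι → ℤ) →+ (ι → ℤ))
    (hM : ∀ v, (∀ i, (N : ℤ) ∣ M v i) ↔ ∀ i, (N : ℤ) ∣ v i) :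
    ∃ g : G, ∀ v, g⁻¹ * E (Multiplicative.ofAdd v) * g = E (Multiplicative.ofAdd (M v)) := by
  obtain ⟨g, hg⟩ := hE.exists_conj hG (F := twist E M)
    (fun v => by rw [twist_ofAdd, hE]; exact hM v)
  exact ⟨g, fun v => hg _⟩

/-- The endomorphism of `ℤ^ι` given by a diagonal matrix. -/
def diagHom {ι : Type*} (d : ι → ℤ) : (ι → ℤ) →+ (ι → ℤ) where
  toFun v i := d i * v i
  map_zero' := by ext; simp
  map_add' v w := by ext; simp [mul_add]

@[simp] theorem diagHom_apply {ι : Type*} (d v : ι → ℤ) (i : ι) : diagHom d v i = d i * v i := rfl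

theorem FreeModulo.exists_conj_diag {G ι : Type*} [Group G] [Finite ι]
    (hG : InnerUltrahomogeneous G) {N : ℕ} {E : Multiplicative (ι → ℤ) →* G}
    (hE : FreeModulo N E) (d : ι → ℤ) (hd : ∀ i, IsCoprime (d i) N) :
    ∃ g : G, ∀ v, g⁻¹ * E (Multiplicative.ofAdd v) * g =
      E (Multiplicative.ofAdd (diagHom d v)) :=
  hE.exists_conj_linear hG _ fun _ => forall_congr' fun i =>
    ⟨(hd i).symm.dvd_of_dvd_mul_left, fun h => h.mul_left _⟩

/-- The endomorphism of `ℤ^ι` permuting the coordinates. -/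
def permHom {ι : Type*} (σ : Equiv.Perm ι) : (ι → ℤ) →+ (ι → ℤ) where
  toFun v i := v (σ.symm i)
  map_zero' := by ext; simp
  map_add' v w := by ext; simp

theorem permHom_single {ι : Type*} [DecidableEq ι] (σ : Equiv.Perm ι) (i : ι) (n : ℤ) :
    permHom σ (Pi.single i n) = Pi.single (σ i) n := by
  ext j
  simp only [permHom, AddMonoidHom.coe_mk, ZeroHom.coe_mk, Pi.single_apply, Equiv.symm_apply_eq]

theorem FreeModulo.exists_conj_perm {G ι : Type*} [Group G] [Finite ι] [DecidableEq ι]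
    (hG : InnerUltrahomogeneous G) {N : ℕ} {E : Multiplicative (ι → ℤ) →* G}
    (hE : FreeModulo N E) (σ : Equiv.Perm ι) :
    ∃ g : G, ∀ i n, g⁻¹ * E (Multiplicative.ofAdd (Pi.single i n)) * g =
      E (Multiplicative.ofAdd (Pi.single (σ i) n)) := by
  obtain ⟨g, hg⟩ := hE.exists_conj_linear hG (permHom σ) fun _ =>
    ⟨fun h i => by simpa [permHom] using h (σ i), fun h i => h _⟩
  exact ⟨g, fun i n => by rw [hg, permHom_single]⟩

/-- The value at a multiple of a basis vector. -/
theorem map_single_eq_zpow {G ι : Type*} [Group G] [DecidableEq ι]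
    (E : Multiplicative (ι → ℤ) →* G) (i : ι) (n : ℤ) :
    E (Multiplicative.ofAdd (Pi.single i n)) = E (Multiplicative.ofAdd (Pi.single i 1)) ^ n := by
  rw [← map_zpow, ← ofAdd_zsmul, ← Pi.single_smul]
  simp

theorem FreeModulo.single_eq_one_iff {G ι : Type*} [Group G] [DecidableEq ι] {N : ℕ}
    {E : Multiplicative (ι → ℤ) →* G} (hE : FreeModulo N E) (i : ι) (n : ℤ) :
    E (Multiplicative.ofAdd (Pi.single i n)) = 1 ↔ (N : ℤ) ∣ n := by
  rw [hE]
  constructor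
  · intro h
    simpa using h i
  · intro h j
    by_cases hj : j = i
    · subst hj; simpa using h
    · simp [hj]

theorem FreeModulo.comp_equiv {G ι κ : Type*} [Group G] {N : ℕ}
    {E : Multiplicative (ι → ℤ) →* G} (hE : FreeModulo N E) (e : κ ≃ ι) :
    ∃ F : Multiplicative (κ → ℤ) →* G, FreeModulo N F := by
  let M : (κ → ℤ) →+ (ι → ℤ) :=
    { toFun := fun v i => v (e.symm i)
      map_zero' := by ext; simp
      map_add' := fun v w => by ext; simp }
  refine ⟨E.comp (AddMonoidHom.toMultiplicative M), fun v => ?_⟩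
  have : (E.comp (AddMonoidHom.toMultiplicative M)) (Multiplicative.ofAdd v) =
    E (Multiplicative.ofAdd (M v)) := rfl
  rw [this, hE]
  exact ⟨fun h i => by simpa [M] using h (e i), fun h i => h _⟩

end Untame

/-! ### Compactness by ultrapowers, and the meaning of the formulas -/

namespace Untame

open FirstOrder FirstOrder.Language

section Compactness

universe w

variable {L : Language} {α β : Type} {M : Type w} [L.Structure M]

/-- An ultrapower of `M` over `ℕ`. -/
noncomputable abbrev Ultrapower (M : Type w) : Type w :=
  (Filter.hyperfilter ℕ : Filter ℕ).Product fun _ => M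

/-- The tuple in the ultrapower given by a sequence of tuples. -/
noncomputable def ultralimit (a : ℕ → α → M) : α → Ultrapower M :=
  fun x => ((fun k => a k x : ℕ → M) : Ultrapower M)

theorem exists_ultralimit_eq (a : α → Ultrapower M) : ∃ a' : ℕ → α → M, ultralimit a' = a :=
  ⟨fun k x => (a x).out k, funext fun x => Quotient.out_eq (a x)⟩

theorem elementarilyEquivalent_ultrapower [Nonempty M] :
    L.ElementarilyEquivalent M (Ultrapower M) := by
  rw [elementarilyEquivalent_iff]
  intro φ
  rw [Ultraproduct.sentence_realize]
  simp

theorem holds_ultralimit [Nonempty M] (φ : L.Formula (α ⊕ β)) (a : ℕ → α → M) (b : ℕ → β → M) :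
    Holds (Ultrapower M) φ (ultralimit a) (ultralimit b) ↔
      ∀ᶠ k in (Filter.hyperfilter ℕ : Filter ℕ), Holds M φ (a k) (b k) := by
  have h := Ultraproduct.realize_formula_cast (M := fun _ : ℕ => M) (u := Filter.hyperfilter ℕ) φ
    (fun i k => Sum.elim (a k) (b k) i)
  have e : (Sum.elim (ultralimit a) (ultralimit b) : α ⊕ β → Ultrapower M) =
      fun i => ((fun k => Sum.elim (a k) (b k) i : ℕ → M) : Ultrapower M) := by
    ext (i | i) <;> rfl
  unfold Holds
  rw [e]
  exact h

theorem eventually_lt_hyperfilter (n : ℕ) : ∀ᶠ k in (Filter.hyperfilter ℕ : Filter ℕ), n < k :=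
  Nat.hyperfilter_le_atTop (Filter.eventually_gt_atTop n)

theorem eventually_hyperfilter_iff {p : ℕ → Prop} {q : Prop} (n : ℕ)
    (h : ∀ k, n < k → (p k ↔ q)) : (∀ᶠ k in (Filter.hyperfilter ℕ : Filter ℕ), p k) ↔ q := by
  rw [Filter.eventually_congr ((eventually_lt_hyperfilter n).mono h)]
  simp

theorem HasIP.hasOP {φ : L.Formula (α ⊕ β)} (h : HasIP M φ) : HasOP M φ := by
  obtain ⟨N, i, hN, a, b, hab⟩ := h
  exact ⟨N, i, hN, a, fun j => b {i | i < j}, fun i j => hab i _⟩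

/-- Take the ultralimit over `k` of the configurations of size `k`: each single condition involves
finitely many indices, hence holds for all large `k`. The analogues below work the same way. -/
theorem hasIP_of_finite [Nonempty M] {φ : L.Formula (α ⊕ β)}
    (h : ∀ k : ℕ, ∃ (a : ℕ → α → M) (b : Set ℕ → β → M),
      ∀ i < k, ∀ S, Holds M φ (a i) (b S) ↔ i ∈ S) : HasIP M φ := by
  choose a b hab using h
  refine ⟨Ultrapower M, inferInstance, elementarilyEquivalent_ultrapower,
    fun i => ultralimit fun k => a k i, fun S => ultralimit fun k => b k S, fun i S => ?_⟩
  rw [holds_ultralimit]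
  exact eventually_hyperfilter_iff i fun k hk => hab k i hk S

theorem hasIPn_of_finite [Nonempty M] {n : ℕ} {γ : Fin n → Type}
    {φ : L.Formula ((Σ j, γ j) ⊕ β)}
    (h : ∀ k : ℕ, ∃ (a : ∀ j : Fin n, ℕ → γ j → M) (b : Set (Fin n → ℕ) → β → M),
      ∀ (i : Fin n → ℕ), (∀ j, i j < k) → ∀ S : Set (Fin n → ℕ),
        Holds M φ (fun v : Σ j, γ j => a v.1 (i v.1) v.2) (b S) ↔ i ∈ S) : HasIPn n M φ := by
  choose a b hab using h
  refine ⟨Ultrapower M, inferInstance, elementarilyEquivalent_ultrapower,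
    fun j i => ultralimit fun k => a k j i, fun S => ultralimit fun k => b k S, fun i S => ?_⟩
  refine (holds_ultralimit φ (fun k (v : Σ j, γ j) => a k v.1 (i v.1) v.2) _).trans ?_
  -- The sum is a common bound for all the `i j`.
  refine eventually_hyperfilter_iff (∑ j, i j) fun k hk => hab k i (fun j => ?_) S
  exact (Finset.single_le_sum (fun _ _ => Nat.zero_le _) (Finset.mem_univ j)).trans_lt hk

theorem hasSOP_of_finite [Nonempty M] {φ : L.Formula (α ⊕ β)}
    (h : ∀ k : ℕ, ∃ b : ℕ → β → M, ∀ i j, i < j → j < k →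
      {a : α → M | Holds M φ a (b i)} ⊂ {a : α → M | Holds M φ a (b j)}) : HasSOP M φ := by
  choose b hb using h
  refine ⟨Ultrapower M, inferInstance, elementarilyEquivalent_ultrapower,
    fun i => ultralimit fun k => b k i, fun i j hij => ?_⟩
  rw [Set.ssubset_iff_exists]
  constructor
  · intro a ha
    obtain ⟨a, rfl⟩ := exists_ultralimit_eq a
    have ha' := (holds_ultralimit φ _ _).1 ha
    refine (holds_ultralimit φ _ _).2 ?_
    filter_upwards [ha', eventually_lt_hyperfilter j] with k h1 h2
    exact (hb k i j hij h2).1 h1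
  · have h' : ∀ k, ∃ a : α → M, j < k → Holds M φ a (b k j) ∧ ¬ Holds M φ a (b k i) := by
      intro k
      by_cases hk : j < k
      · obtain ⟨a, h1, h2⟩ := Set.exists_of_ssubset (hb k i j hij hk)
        exact ⟨a, fun _ => ⟨h1, h2⟩⟩
      · exact ⟨fun _ => Classical.arbitrary M, fun h => absurd h hk⟩
    choose a ha using h'
    refine ⟨ultralimit a, (holds_ultralimit φ _ _).2 ?_, fun hn => ?_⟩
    · filter_upwards [eventually_lt_hyperfilter j] with k hk
      exact (ha k hk).1
    · have hn' := (holds_ultralimit φ _ _).1 hn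
      obtain ⟨k, h1, h2⟩ := (hn'.and (eventually_lt_hyperfilter j)).exists
      exact (ha k h2).2 h1

theorem hasTP2_of_finite [Nonempty M] {φ : L.Formula (α ⊕ β)}
    (h : ∀ k : ℕ, ∃ b : ℕ → ℕ → β → M,
      (∀ i < k, ∀ j j', j < j' → j' < k → ∀ a, ¬ (Holds M φ a (b i j) ∧ Holds M φ a (b i j'))) ∧
      (∀ f : ℕ → ℕ, (∀ i, f i < k) → ∃ a : α → M, ∀ i < k, Holds M φ a (b i (f i)))) :
    HasTP2 M φ := by
  choose b hb₁ hb₂ using h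
  refine ⟨Ultrapower M, inferInstance, elementarilyEquivalent_ultrapower,
    fun i j => ultralimit fun k => b k i j, 2, ?_, ?_⟩
  · rintro i s hs ⟨a, ha⟩
    obtain ⟨a, rfl⟩ := exists_ultralimit_eq a
    have key : ∀ j ∈ s, ∀ j' ∈ s, j < j' → False := by
      intro j hj j' hj' hlt
      have e₁ := (holds_ultralimit φ _ _).1 (ha j hj)
      have e₂ := (holds_ultralimit φ _ _).1 (ha j' hj')
      obtain ⟨k, h1, h2, h3, h4⟩ := (e₁.and (e₂.and
        ((eventually_lt_hyperfilter i).and (eventually_lt_hyperfilter j')))).exists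
      exact hb₁ k i h3 j j' hlt h4 _ ⟨h1, h2⟩
    obtain ⟨x, y, hxy, rfl⟩ := Finset.card_eq_two.1 hs
    rcases lt_or_gt_of_ne hxy with h | h
    · exact key x (by simp) y (by simp) h
    · exact key y (by simp) x (by simp) h
  · intro f
    have h' : ∀ k, ∃ a : α → M, ∀ i < k, f i < k → Holds M φ a (b k i (f i)) := by
      intro k
      rcases Nat.eq_zero_or_pos k with rfl | hk
      · exact ⟨fun _ => Classical.arbitrary M, fun i hi => absurd hi (Nat.not_lt_zero _)⟩
      -- The finite hypothesis needs a path with values below `k`; the values of `f` that are too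
      -- large are replaced by `0`, which affects no coordinate under consideration.
      · obtain ⟨a, ha⟩ := hb₂ k (fun i => if f i < k then f i else 0)
          (fun i => by split_ifs <;> assumption)
        refine ⟨a, fun i hi hf => ?_⟩
        simpa [hf] using ha i hi
    choose a ha using h'
    refine ⟨ultralimit a, fun i => (holds_ultralimit φ _ _).2 ?_⟩
    filter_upwards [eventually_lt_hyperfilter i, eventually_lt_hyperfilter (f i)] with k h1 h2
    exact ha k i h1 h2

end Compactness

section Formulas

variable {G : Type*} [Group G] {α : Type}

theorem realize_mul {v : α → G} (s t : groupLang.Term α) :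
    (s * t).realize v = s.realize v * t.realize v := by
  change (mulSymb.apply₂ s t).realize v = _
  rw [Term.realize_functions_apply₂]
  rfl

theorem realize_inv {v : α → G} (s : groupLang.Term α) :
    (s⁻¹).realize v = (s.realize v)⁻¹ := by
  change (invSymb.apply₁ s).realize v = _
  rw [Term.realize_functions_apply₁]
  rfl

theorem realize_one {v : α → G} : (1 : groupLang.Term α).realize v = 1 := by
  change (Constants.term oneSymb).realize v = _
  rw [Term.realize_constants]
  rfl

theorem realize_list_prod {v : α → G} (l : List (groupLang.Term α)) :
    l.prod.realize v = (l.map (Term.realize v)).prod := by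
  induction l with
  | nil => simpa using realize_one
  | cons t l ih =>
    rw [List.map_cons]
    exact (realize_mul t l.prod).trans (congrArg _ ih)

theorem realize_commFormula {v : α → G} (s t : groupLang.Term α) :
    (commFormula s t).Realize v ↔ Commute (s.realize v) (t.realize v) := by
  rw [commFormula, Formula.realize_equal, realize_mul, realize_mul]
  rfl

theorem holds_commXY (a b : Fin 1 → G) : Holds G commXY a b ↔ Commute (a 0) (b 0) := by
  rw [Holds, commXY, realize_commFormula]
  rfl

theorem holds_conjProdComm {n : ℕ} (a : (Σ _ : Fin n, Fin 1) → G) (b : Fin 2 → G) :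
    Holds G (conjProdComm n) a b ↔
      Commute ((List.ofFn fun j => a ⟨j, 0⟩).prod⁻¹ * b 0 * (List.ofFn fun j => a ⟨j, 0⟩).prod)
        (b 1) := by
  rw [Holds, conjProdComm, realize_commFormula, realize_mul, realize_mul, realize_inv,
    realize_list_prod, List.map_ofFn]
  rfl

theorem holds_centralizerLe (a b : Fin 1 → G) :
    Holds G centralizerLe a b ↔ ∀ z, Commute z (a 0) → Commute z (b 0) := by
  have key : ∀ (v : (Fin 1 ⊕ Fin 1) → G) (xs : Fin 1 → G)
      (s t : groupLang.Term ((Fin 1 ⊕ Fin 1) ⊕ Fin 1)),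
      (Term.bdEqual (s * t) (t * s)).Realize v xs ↔
        Commute (s.realize (Sum.elim v xs)) (t.realize (Sum.elim v xs)) := by
    intro v xs s t
    rw [BoundedFormula.realize_bdEqual, realize_mul, realize_mul]
    rfl
  rw [Holds, centralizerLe, Formula.Realize, BoundedFormula.realize_all]
  refine forall_congr' fun z => ?_
  rw [BoundedFormula.realize_imp, key, key]
  rfl

theorem holds_centralizerDiff (a : Fin 1 → G) (b : Fin 2 → G) :
    Holds G centralizerDiff a b ↔ Commute (a 0) (b 1) ∧ ¬ Commute (a 0) (b 0) := by
  rw [Holds, centralizerDiff, Formula.realize_inf, Formula.realize_not, realize_commFormula,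
    realize_commFormula]
  rfl

end Formulas

end Untame

/-! ### From free modules and centralizer chains to the four properties -/

namespace Untame

/-- `G` contains, in every finite rank, free `ℤ/N`-modules with `N ≠ 1, 2`. -/
def HasLargeFree (G : Type*) [Group G] : Prop :=
  ∀ m : ℕ, ∃ (N : ℕ) (E : Multiplicative (Fin m → ℤ) →* G), FreeModulo N E ∧ N ≠ 1 ∧ N ≠ 2

/-- For every `k` there are `k` chains of centralizers of length `k` which are independent of each
other. -/
def HasCentralizerChains (G : Type*) [Group G] : Prop :=
  ∀ k : ℕ, ∃ (e : Fin k → G) (d : ℕ), ∀ f : Fin k → ℕ, (∀ i, f i < k) →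
    ∃ x, ∀ i, Commute x (e i ^ d ^ (f i + 1)) ∧ ¬ Commute x (e i ^ d ^ f i)

variable {G : Type*} [Group G]

theorem commute_iff_conj_eq {x g : G} : Commute x g ↔ g⁻¹ * x * g = x := by
  rw [mul_assoc, inv_mul_eq_iff_eq_mul]
  exact Iff.rfl

/-- Conjugate so as to fix the basis elements in `S` and invert the others; an inverted one really
moves because `N` does not divide `2`. -/
theorem FreeModulo.exists_commute_iff {ι : Type*} [Finite ι] [DecidableEq ι]
    (hG : InnerUltrahomogeneous G) {N : ℕ} (h1 : N ≠ 1) (h2 : N ≠ 2)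
    {E : Multiplicative (ι → ℤ) →* G} (hE : FreeModulo N E) (S : Set ι) :
    ∃ g : G, ∀ i, Commute (E (Multiplicative.ofAdd (Pi.single i 1))) g ↔ i ∈ S := by
  classical
  obtain ⟨g, hg⟩ := hE.exists_conj_diag hG (fun i => if i ∈ S then 1 else -1) (fun i => by
    split_ifs
    · exact isCoprime_one_left
    · exact isCoprime_one_left.neg_left)
  refine ⟨g, fun i => ?_⟩
  have hd : diagHom (fun i => if i ∈ S then (1 : ℤ) else -1) (Pi.single i 1) =
      Pi.single i (if i ∈ S then 1 else -1) := by
    ext j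
    by_cases hj : j = i
    · subst hj; simp
    · simp [hj]
  rw [commute_iff_conj_eq, hg, hd]
  by_cases hi : i ∈ S
  · simp [hi]
  · simp only [hi, if_false, iff_false]
    intro h
    rw [map_single_eq_zpow, zpow_neg_one, inv_eq_iff_mul_eq_one, ← pow_two, ← zpow_natCast,
      ← map_single_eq_zpow, hE.single_eq_one_iff] at h
    have h' : N ∣ 2 := by exact_mod_cast h
    rcases (Nat.dvd_prime Nat.prime_two).1 h' with h | h
    · exact h1 h
    · exact h2 h

theorem conj_list_prod_single {ι : Type*} [AddCommGroup ι] (e : ι → G) (l : List (G × ι))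
    (hl : ∀ p ∈ l, ∀ w, p.1⁻¹ * e w * p.1 = e (w + p.2)) (w : ι) :
    (l.map Prod.fst).prod⁻¹ * e w * (l.map Prod.fst).prod = e (w + (l.map Prod.snd).sum) := by
  induction l generalizing w with
  | nil => simp
  | cons p l ih =>
    have h1 := hl p (by simp) w
    have h2 := ih (fun q hq => hl q (by simp [hq])) (w + p.2)
    simp only [List.map_cons, List.prod_cons, List.sum_cons]
    rw [← add_assoc, ← h2, ← h1]
    group

theorem HasLargeFree.hasIP (hG : InnerUltrahomogeneous G) (h : HasLargeFree G) :
    HasIP G commXY := by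
  refine hasIP_of_finite fun k => ?_
  obtain ⟨N, E, hE, h1, h2⟩ := h k
  choose b hb using fun S : Set (Fin k) => hE.exists_commute_iff hG h1 h2 S
  refine ⟨fun i _ => if hi : i < k then E (Multiplicative.ofAdd (Pi.single ⟨i, hi⟩ 1)) else 1,
    fun S _ => b {i | (i : ℕ) ∈ S}, fun i hi S => ?_⟩
  rw [holds_commXY]
  simp only [hi, dite_true]
  rw [hb]
  rfl

/-- Index a basis by the grid `(ℤ/(k+1))ⁿ` and realise the translations by conjugators. The product
of the translations by `i j` along the axes `j` carries the basis element at `0` to the one at `i`,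
and `y₂` is chosen to commute with exactly the prescribed basis elements. -/
theorem HasLargeFree.hasIPn (hG : InnerUltrahomogeneous G) (h : HasLargeFree G) (n : ℕ) :
    HasIPn n G (conjProdComm n) := by
  classical
  refine hasIPn_of_finite fun k => ?_
  -- The modulus `k + 1` is nonzero even for `k = 0`, and indices below `k` are recovered from their
  -- residues.
  obtain ⟨N, E₀, hE₀, h1, h2⟩ := h (Fintype.card (Fin n → ZMod (k + 1)))
  obtain ⟨E, hE⟩ := hE₀.comp_equiv (Fintype.equivFin (Fin n → ZMod (k + 1)))
  choose b hb using fun S : Set (Fin n → ZMod (k + 1)) => hE.exists_commute_iff hG h1 h2 S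
  choose x hx using fun w : Fin n → ZMod (k + 1) => hE.exists_conj_perm hG (Equiv.addRight w)
  refine ⟨fun j i _ => x (Pi.single j i),
    fun S => ![E (Multiplicative.ofAdd (Pi.single 0 1)), b {w | (fun j => (w j).val) ∈ S}],
    fun i hi S => ?_⟩
  rw [holds_conjProdComm]
  have key := conj_list_prod_single (fun w => E (Multiplicative.ofAdd (Pi.single w 1)))
    (List.ofFn fun j : Fin n => (x (Pi.single j (i j : ZMod (k + 1))),
      (Pi.single j (i j : ZMod (k + 1)) : Fin n → ZMod (k + 1))))
    (by
      intro p hp w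
      obtain ⟨j, rfl⟩ := List.mem_ofFn.1 hp
      exact hx _ w 1) 0
  simp only [List.map_ofFn, Function.comp_def, List.sum_ofFn, Finset.univ_sum_single,
    zero_add] at key
  simp only [Matrix.cons_val_zero, Matrix.cons_val_one]
  rw [key, hb]
  have : (fun j => ((i j : ZMod (k + 1))).val) = i :=
    funext fun j => ZMod.val_cast_of_lt ((hi j).trans (Nat.lt_succ_self k))
  rw [Set.mem_ofPred_eq, this]

theorem HasCentralizerChains.hasSOP (h : HasCentralizerChains G) : HasSOP G centralizerLe := by
  refine hasSOP_of_finite fun k => ?_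
  rcases Nat.eq_zero_or_pos k with rfl | hk
  · exact ⟨fun _ _ => 1, fun i j _ hj => absurd hj (Nat.not_lt_zero _)⟩
  obtain ⟨e, d, he⟩ := h k
  have mono : ∀ {i j : ℕ} {z : G}, i ≤ j → Commute z (e ⟨0, hk⟩ ^ d ^ i) →
      Commute z (e ⟨0, hk⟩ ^ d ^ j) := by
    intro i j z hij hz
    obtain ⟨c, rfl⟩ := Nat.exists_eq_add_of_le hij
    rw [pow_add, pow_mul]
    exact hz.pow_right _
  refine ⟨fun i _ => e ⟨0, hk⟩ ^ d ^ i, fun i j hij hj => ?_⟩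
  rw [Set.ssubset_iff_exists]
  constructor
  · intro a ha
    rw [Set.mem_ofPred_eq, holds_centralizerLe] at ha ⊢
    exact fun z hz => mono hij.le (ha z hz)
  -- This `z` commutes with the `d ^ j`-th power but not with the `d ^ (j - 1)`-th, hence not with
  -- the `d ^ i`-th.
  · obtain ⟨z, hz⟩ := he (fun _ => j - 1) (fun _ => (Nat.sub_le _ _).trans_lt hj)
    obtain ⟨hz₁, hz₂⟩ := hz ⟨0, hk⟩
    rw [Nat.sub_add_cancel (Nat.one_le_of_lt hij)] at hz₁
    refine ⟨fun _ => e ⟨0, hk⟩ ^ d ^ j, ?_, ?_⟩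
    · rw [Set.mem_ofPred_eq, holds_centralizerLe]
      exact fun _ => id
    · rw [Set.mem_ofPred_eq, holds_centralizerLe]
      exact fun hc => hz₂ (mono (Nat.le_sub_one_of_lt hij) (hc z hz₁))

/-- Row `i` consists of the successive differences of the `i`-th chain of centralizers, which are
pairwise disjoint; independence of the chains gives the paths. -/
theorem HasCentralizerChains.hasTP2 (h : HasCentralizerChains G) : HasTP2 G centralizerDiff := by
  refine hasTP2_of_finite fun k => ?_
  obtain ⟨e, d, he⟩ := h k
  refine ⟨fun i j => if hi : i < k then ![e ⟨i, hi⟩ ^ d ^ j, e ⟨i, hi⟩ ^ d ^ (j + 1)] else 1,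
    fun i hi j j' hjj' _ a => ?_, fun f hf => ?_⟩
  · rw [holds_centralizerDiff, holds_centralizerDiff]
    simp only [hi, dite_true, Matrix.cons_val_zero, Matrix.cons_val_one]
    rintro ⟨⟨h1, -⟩, -, h2⟩
    apply h2
    obtain ⟨c, rfl⟩ := Nat.exists_eq_add_of_lt hjj'
    rw [show j + c + 1 = (j + 1) + c by ring, pow_add, pow_mul]
    exact h1.pow_right _
  · obtain ⟨x, hx⟩ := he (fun i => f i) (fun i => hf i)
    refine ⟨fun _ => x, fun i hi => ?_⟩
    rw [holds_centralizerDiff]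
    simp only [hi, dite_true, Matrix.cons_val_zero, Matrix.cons_val_one]
    exact hx ⟨i, hi⟩

end Untame

/-! ### Torsion groups with elements of order `q ^ n` for all `n` -/

namespace Untame

variable {G : Type*} [Group G]

/-- Extension of a homomorphism on `ℤ^m` by a commuting element. -/
def extendHom {m : ℕ} (E : Multiplicative (Fin m → ℤ) →* G) (t : G)
    (ht : ∀ v, Commute (E v) t) : Multiplicative (Fin (m + 1) → ℤ) →* G where
  toFun v := E (Multiplicative.ofAdd (Fin.tail v.toAdd)) * t ^ (v.toAdd 0)
  map_one' := by
    have : Fin.tail (0 : Fin (m + 1) → ℤ) = 0 := rfl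
    simp [this]
  map_mul' v w := by
    have : Fin.tail (v.toAdd + w.toAdd) = Fin.tail v.toAdd + Fin.tail w.toAdd := rfl
    rw [toAdd_mul, this, ofAdd_add, map_mul, Pi.add_apply, zpow_add]
    have h := ((ht (Multiplicative.ofAdd (Fin.tail w.toAdd))).zpow_right (v.toAdd 0)).eq
    simp only [mul_assoc]
    rw [← mul_assoc (t ^ _) (E _), ← h]
    simp only [mul_assoc]

theorem extendHom_ofAdd {m : ℕ} (E : Multiplicative (Fin m → ℤ) →* G) (t : G)
    (ht : ∀ v, Commute (E v) t) (v : Fin (m + 1) → ℤ) :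
    extendHom E t ht (Multiplicative.ofAdd v) =
      E (Multiplicative.ofAdd (Fin.tail v)) * t ^ v 0 := rfl

/-- In any relation, `h₂` forces the exponent of `t` to be a multiple of `N`, where `t` contributes
nothing. -/
theorem FreeModulo.extend {m N : ℕ} {E : Multiplicative (Fin m → ℤ) →* G} (hE : FreeModulo N E)
    {t : G} (ht : ∀ v, Commute (E v) t) (h₁ : t ^ N = 1)
    (h₂ : ∀ (n : ℤ) v, t ^ n = E v → (N : ℤ) ∣ n) : FreeModulo N (extendHom E t ht) := by
  intro v
  have h3 : ∀ n : ℤ, (N : ℤ) ∣ n → t ^ n = 1 := by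
    rintro _ ⟨c, rfl⟩
    rw [zpow_mul, zpow_natCast, h₁, one_zpow]
  rw [extendHom_ofAdd, Fin.forall_fin_succ]
  constructor
  · intro h
    have h0 : (N : ℤ) ∣ v 0 := by
      refine h₂ _ (Multiplicative.ofAdd (Fin.tail v))⁻¹ ?_
      rw [map_inv]
      exact (inv_eq_of_mul_eq_one_right h).symm
    rw [h3 _ h0, mul_one, hE] at h
    exact ⟨h0, h⟩
  · rintro ⟨h0, h⟩
    rw [h3 _ h0, mul_one, hE]
    exact h

theorem FreeModulo.tail {m N : ℕ} {E : Multiplicative (Fin (m + 1) → ℤ) →* G}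
    (hE : FreeModulo N E) : ∃ F : Multiplicative (Fin m → ℤ) →* G, FreeModulo N F := by
  let M : (Fin m → ℤ) →+ (Fin (m + 1) → ℤ) :=
    { toFun := fun v => Fin.cons 0 v
      map_zero' := by ext i; refine Fin.cases ?_ (fun j => ?_) i <;> simp
      map_add' := fun v w => by ext i; refine Fin.cases ?_ (fun j => ?_) i <;> simp }
  refine ⟨E.comp (AddMonoidHom.toMultiplicative M), fun v => ?_⟩
  have : (E.comp (AddMonoidHom.toMultiplicative M)) (Multiplicative.ofAdd v) =
    E (Multiplicative.ofAdd (Fin.cons 0 v)) := rfl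
  rw [this, hE, Fin.forall_fin_succ]
  simp

theorem freeModulo_fin_zero (N : ℕ) : FreeModulo N (1 : Multiplicative (Fin 0 → ℤ) →* G) :=
  fun _ => by simp

theorem exists_freeModulo_one {N : ℕ} {a : G} (ha : orderOf a = N) :
    ∃ E : Multiplicative (Fin 1 → ℤ) →* G, FreeModulo N E :=
  ⟨_, (freeModulo_fin_zero N).extend (t := a) (fun _ => Commute.one_left _)
    (ha ▸ pow_orderOf_eq_one a) (fun n _ h => by
      rw [← ha]
      exact orderOf_dvd_iff_zpow_eq_one.2 h)⟩

theorem one_add_sq_pow_modEq (Q : ℤ) (n : ℕ) : Q ^ 4 ∣ (1 + Q ^ 2) ^ n - (1 + n * Q ^ 2) := by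
  induction n with
  | zero => simp
  | succ n ih =>
    obtain ⟨c, hc⟩ := ih
    refine ⟨c * (1 + Q ^ 2) + n, ?_⟩
    rw [pow_succ, sub_eq_iff_eq_add.1 hc]
    push_cast
    ring

theorem conj_pow_of_conj_smul {m : ℕ} {E : Multiplicative (Fin m → ℤ) →* G} {t : G} {d : ℤ}
    (ht : ∀ v : Fin m → ℤ, t⁻¹ * E (Multiplicative.ofAdd v) * t = E (Multiplicative.ofAdd (d • v)))
    (n : ℕ) (v : Fin m → ℤ) :
    (t ^ n)⁻¹ * E (Multiplicative.ofAdd v) * t ^ n = E (Multiplicative.ofAdd (d ^ n • v)) := by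
  induction n with
  | zero => simp
  | succ n ih =>
    rw [pow_succ d, mul_comm, mul_smul, ← ht, ← ih]
    group

theorem FreeModulo.eq_iff {ι : Type*} {N : ℕ} {E : Multiplicative (ι → ℤ) →* G}
    (hE : FreeModulo N E) (v w : ι → ℤ) :
    E (Multiplicative.ofAdd v) = E (Multiplicative.ofAdd w) ↔ ∀ i, (N : ℤ) ∣ v i - w i := by
  rw [← div_eq_one, ← map_div, ← ofAdd_sub, hE]
  rfl

/-- In a torsion inner ultrahomogeneous group, a homocyclic subgroup of exponent `Q ^ 4` gives one
of exponent `Q` and larger rank. -/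
theorem FreeModulo.exists_succ (hG : InnerUltrahomogeneous G) (htors : ∀ g : G, IsOfFinOrder g)
    {m Q : ℕ} (hQ : 0 < Q) {E : Multiplicative (Fin (m + 1) → ℤ) →* G} (hE : FreeModulo (Q ^ 4) E) :
    ∃ F : Multiplicative (Fin (m + 2) → ℤ) →* G, FreeModulo Q F := by
  have hQ0 : (Q : ℤ) ≠ 0 := by exact_mod_cast hQ.ne'
  set d : ℤ := 1 + (Q : ℤ) ^ 2 with hd
  obtain ⟨t, ht'⟩ := hE.exists_conj_diag hG (fun _ => d) (fun _ => by
    push_cast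
    refine IsCoprime.pow_right ⟨1, -Q, by rw [hd]; ring⟩)
  have ht : ∀ v : Fin (m + 1) → ℤ, t⁻¹ * E (Multiplicative.ofAdd v) * t =
    E (Multiplicative.ofAdd (d • v)) := ht'
  have hex : ∃ n : ℕ, 0 < n ∧ t ^ n ∈ E.range :=
    ⟨orderOf t, (htors t).orderOf_pos, by rw [pow_orderOf_eq_one]; exact one_mem _⟩
  classical
  -- `r` is the order of `t` modulo the image of `E`, which `t` normalizes.
  set r := Nat.find hex with hr
  obtain ⟨hr0, hrE⟩ := Nat.find_spec hex
  rw [← hr] at hr0 hrE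
  have hdvd : ∀ n : ℤ, t ^ n ∈ E.range → (r : ℤ) ∣ n := by
    intro n hn
    by_contra hnd
    have hpos : 0 < n % r := by
      have h1 := Int.emod_nonneg n (by exact_mod_cast hr0.ne' : (r : ℤ) ≠ 0)
      have h2 : n % r ≠ 0 := fun h => hnd (Int.dvd_of_emod_eq_zero h)
      omega
    have hlt := Int.emod_lt_of_pos n (by exact_mod_cast hr0 : (0 : ℤ) < r)
    obtain ⟨s, hs⟩ := Int.eq_ofNat_of_zero_le hpos.le
    have hmem : t ^ s ∈ E.range := by
      have : t ^ s = t ^ n * ((t ^ r) ^ (n / r))⁻¹ := by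
        rw [← zpow_natCast, ← hs, Int.emod_def, zpow_sub, zpow_mul, zpow_natCast]
      rw [this]
      exact mul_mem hn (inv_mem (zpow_mem hrE _))
    exact Nat.find_min hex (m := s) (by omega) ⟨by omega, hmem⟩
  obtain ⟨w, hw⟩ := hrE
  -- `t` commutes with its power `t ^ r = E w`, so `Q ^ 2 w` vanishes modulo `Q ^ 4`.
  have hw' : ∀ i, (Q : ℤ) ^ 2 ∣ w.toAdd i := by
    have h1 : E (Multiplicative.ofAdd (d • w.toAdd)) = E (Multiplicative.ofAdd w.toAdd) := by
      rw [← ht, ofAdd_toAdd, hw]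
      group
    rw [hE.eq_iff] at h1
    intro i
    have h2 := h1 i
    have h3 : (d • w.toAdd) i - w.toAdd i = (Q : ℤ) ^ 2 * w.toAdd i := by
      rw [Pi.smul_apply, smul_eq_mul, hd]; ring
    rw [h3] at h2
    push_cast at h2
    rw [show (Q : ℤ) ^ 4 = Q ^ 2 * Q ^ 2 by ring] at h2
    exact Int.dvd_of_mul_dvd_mul_left (pow_ne_zero 2 hQ0) h2
  choose w' hw' using hw'
  -- `t ^ r` lies in the abelian image, so it acts trivially there: `d ^ r`, which is `1 + r Q ^ 2`
  -- modulo `Q ^ 4`, must be `1`.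
  have hrQ : (Q : ℤ) ^ 2 ∣ r := by
    have h1 : E (Multiplicative.ofAdd (d ^ r • Pi.single 0 1)) =
        E (Multiplicative.ofAdd (Pi.single 0 1)) := by
      rw [← conj_pow_of_conj_smul ht, ← hw, mul_assoc, inv_mul_eq_iff_eq_mul, ← map_mul, ← map_mul,
        mul_comm]
    rw [hE.eq_iff] at h1
    have h2 := h1 0
    simp only [Pi.smul_apply, Pi.single_eq_same, smul_eq_mul, mul_one] at h2
    push_cast at h2
    have h3 := dvd_sub h2 (one_add_sq_pow_modEq (Q : ℤ) r)
    rw [← hd, show d ^ r - 1 - (d ^ r - (1 + r * (Q : ℤ) ^ 2)) = (Q : ℤ) ^ 2 * r by ring,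
      show (Q : ℤ) ^ 4 = Q ^ 2 * Q ^ 2 by ring] at h3
    exact Int.dvd_of_mul_dvd_mul_left (pow_ne_zero 2 hQ0) h3
  obtain ⟨s, hs⟩ : Q ^ 2 ∣ r := by exact_mod_cast hrQ
  have hs0 : (s : ℤ) ≠ 0 := by
    rintro h
    have : s = 0 := by exact_mod_cast h
    rw [this, mul_zero] at hs
    omega
  have hact : ∀ v : Fin (m + 1) → ℤ, Commute (E (Multiplicative.ofAdd ((Q : ℤ) • v)))
      (t ^ (Q * s)) := by
    intro v
    rw [commute_iff_conj_eq, conj_pow_of_conj_smul ht, hE.eq_iff]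
    intro i
    obtain ⟨c, hc⟩ := one_add_sq_pow_modEq (Q : ℤ) (Q * s)
    rw [← hd] at hc
    refine ⟨(c * Q + s) * v i, ?_⟩
    simp only [Pi.smul_apply, smul_eq_mul]
    rw [sub_eq_iff_eq_add.1 hc]
    push_cast
    ring
  -- With `r = Q ^ 2 s` and `w = Q ^ 2 w'`, the correction makes the `Q`-th power `t ^ r (E w)⁻¹ =
  -- 1`. The new module is generated by `u` and the `Q ^ 3`-multiples, which `u` centralizes.
  set u := t ^ (Q * s) * (E (Multiplicative.ofAdd ((Q : ℤ) • w')))⁻¹ with hu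
  have hcomm := (hact w').symm.inv_right
  have huQ : u ^ Q = 1 := by
    rw [hu, hcomm.mul_pow, ← pow_mul, show Q * s * Q = r by rw [hs]; ring, ← hw, inv_pow,
      ← map_pow, ← ofAdd_nsmul, mul_inv_eq_one]
    congr 1
    refine Multiplicative.toAdd.injective (funext fun i => ?_)
    rw [hw' i]
    simp
    ring
  have hE₁ : FreeModulo Q (twist E (diagHom fun _ => (Q : ℤ) ^ 3)) := by
    intro v
    rw [twist_ofAdd, hE]
    refine forall_congr' fun i => ?_
    rw [diagHom_apply]
    push_cast
    rw [show (Q : ℤ) ^ 4 = Q ^ 3 * Q by ring]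
    exact mul_dvd_mul_iff_left (pow_ne_zero 3 hQ0)
  have hmul : ∀ v : Fin (m + 1) → ℤ, diagHom (fun _ => (Q : ℤ) ^ 3) v =
      (Q : ℤ) • ((Q : ℤ) ^ 2 • v) := by
    intro v
    ext i
    simp only [diagHom_apply, Pi.smul_apply, smul_eq_mul]
    ring
  have hcomm' : ∀ v, Commute (twist E (diagHom fun _ => (Q : ℤ) ^ 3) v) u := by
    intro v
    rw [← ofAdd_toAdd v, twist_ofAdd, hmul]
    refine (hact _).mul_right (Commute.inv_right ((Commute.all _ _).map E))
  refine ⟨_, hE₁.extend hcomm' huQ fun n v hn => ?_⟩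
  have hmem : t ^ ((Q * s : ℕ) * n : ℤ) ∈ E.range := by
    have h1 : u ^ n ∈ E.range := by rw [hn]; exact ⟨_, rfl⟩
    rw [hu, hcomm.mul_zpow] at h1
    rw [zpow_mul, zpow_natCast]
    exact (Subgroup.mul_mem_cancel_right _ 
      (zpow_mem (inv_mem (MonoidHom.mem_range.2 ⟨_, rfl⟩)) _)).1 h1
  have h2 := hdvd _ hmem
  rw [hs] at h2
  push_cast at h2
  rw [show (Q : ℤ) ^ 2 * s = Q * s * Q by ring] at h2
  exact Int.dvd_of_mul_dvd_mul_left (mul_ne_zero hQ0 hs0) h2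

theorem exists_freeModulo_of_orderOf (hG : InnerUltrahomogeneous G)
    (htors : ∀ g : G, IsOfFinOrder g) (m : ℕ) {Q : ℕ} (hQ : 0 < Q) {a : G}
    (ha : orderOf a = Q ^ 4 ^ m) :
    ∃ E : Multiplicative (Fin (m + 1) → ℤ) →* G, FreeModulo Q E := by
  induction m generalizing Q with
  | zero => exact exists_freeModulo_one (by simpa using ha)
  | succ m ih =>
    obtain ⟨E, hE⟩ := ih (Q := Q ^ 4) (by positivity) (by rw [ha, pow_succ', pow_mul])
    exact hE.exists_succ hG htors hQ

theorem exists_freeModulo_pow (hG : InnerUltrahomogeneous G)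
    (htors : ∀ g : G, IsOfFinOrder g) {q : ℕ} (hq : 0 < q)
    (h : ∀ n, ∃ a : G, orderOf a = q ^ n) (m j : ℕ) :
    ∃ E : Multiplicative (Fin m → ℤ) →* G, FreeModulo (q ^ j) E := by
  obtain ⟨a, ha⟩ := h (j * 4 ^ m)
  obtain ⟨E, hE⟩ := exists_freeModulo_of_orderOf hG htors m (Q := q ^ j) (by positivity)
    (by rw [ha, pow_mul])
  exact hE.tail

theorem hasLargeFree_of_torsion (hG : InnerUltrahomogeneous G)
    (htors : ∀ g : G, IsOfFinOrder g) {q : ℕ} (hq : 1 < q)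
    (h : ∀ n, ∃ a : G, orderOf a = q ^ n) : HasLargeFree G := by
  intro m
  -- The exponent `2` ensures that the modulus is at least `4`.
  obtain ⟨E, hE⟩ := exists_freeModulo_pow hG htors (by omega) h m 2
  refine ⟨_, E, hE, ?_, ?_⟩ <;> nlinarith

/-- Over `ℤ/q^(k+1)`, let `x` multiply the `i`-th coordinate by `1 + q ^ (k - f i)`, a unit since `f
i < k`. It fixes `q ^ j` times the `i`-th basis vector exactly when `j > f i`. -/
theorem hasCentralizerChains_of_torsion (hG : InnerUltrahomogeneous G)
    (htors : ∀ g : G, IsOfFinOrder g) {q : ℕ} (hq : 1 < q)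
    (h : ∀ n, ∃ a : G, orderOf a = q ^ n) : HasCentralizerChains G := by
  intro k
  obtain ⟨E, hE⟩ := exists_freeModulo_pow hG htors (by omega) h k (k + 1)
  refine ⟨fun i => E (Multiplicative.ofAdd (Pi.single i 1)), q, fun f hf => ?_⟩
  obtain ⟨x, hx⟩ := hE.exists_conj_diag hG (fun i => 1 + (q : ℤ) ^ (k - f i)) (fun i => by
    push_cast
    refine IsCoprime.pow_right ?_
    obtain ⟨c, hc⟩ := Nat.exists_eq_add_of_lt (hf i)
    refine ⟨1, -(q : ℤ) ^ c, ?_⟩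
    rw [show k - f i = c + 1 by omega]
    ring)
  have key : ∀ i (j : ℕ), Commute x (E (Multiplicative.ofAdd (Pi.single i 1)) ^ q ^ j) ↔
      q ^ (k + 1) ∣ q ^ (k - f i + j) := by
    intro i j
    rw [show Commute x _ ↔ Commute _ x from ⟨Commute.symm, Commute.symm⟩, commute_iff_conj_eq,
      ← zpow_natCast, ← map_single_eq_zpow, hx, hE.eq_iff]
    have h1 : ∀ i', (diagHom fun i => 1 + (q : ℤ) ^ (k - f i)) (Pi.single i ((q ^ j : ℕ) : ℤ)) i' -
        (Pi.single i ((q ^ j : ℕ) : ℤ) : Fin k → ℤ) i' =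
        (Pi.single i ((q ^ (k - f i + j) : ℕ) : ℤ) : Fin k → ℤ) i' := by
      intro i'
      by_cases hi : i' = i
      · subst hi
        simp [pow_add]
        ring
      · simp [hi]
    simp only [h1]
    constructor
    · intro h2
      have := h2 i
      rw [Pi.single_eq_same] at this
      exact_mod_cast this
    · intro h2 i'
      by_cases hi : i' = i
      · subst hi
        rw [Pi.single_eq_same]
        exact_mod_cast h2
      · simp [hi]
  refine ⟨x, fun i => ⟨(key i _).2 ?_, fun hc => ?_⟩⟩
  · rw [show k - f i + (f i + 1) = k + 1 by have := hf i; omega]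
  · have := (Nat.pow_dvd_pow_iff_le_right hq).1 ((key i _).1 hc)
    have := hf i
    omega

end Untame

/-! ### Groups with an element of infinite order -/

namespace Untame

section Tower

variable {H : Type*} [Group H] {m : ℕ}

/-- The basis elements of `ℤ^m` raise `a` to the powers `p i`, by conjugation through `T`. -/
def ActsByPowers (T : Multiplicative (Fin m → ℤ) →* H) (a : H) (p : Fin m → ℕ) : Prop :=
  ∀ i, (T (Multiplicative.ofAdd (Pi.single i 1)))⁻¹ * a * T (Multiplicative.ofAdd (Pi.single i 1)) =
    a ^ p i

/-- A vector of natural numbers, as an element of the multiplicative copy of `ℤ^m`. -/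
def natVec (n : Fin m → ℕ) : Multiplicative (Fin m → ℤ) := Multiplicative.ofAdd fun i => (n i : ℤ)

theorem conj_pow_of_conj_eq_pow {t a : H} {p : ℕ} (h : t⁻¹ * a * t = a ^ p) (n : ℕ) :
    (t ^ n)⁻¹ * a * t ^ n = a ^ p ^ n := by
  induction n with
  | zero => simp
  | succ n ih =>
    have h1 : t⁻¹ * a ^ p ^ n * t = (t⁻¹ * a * t) ^ p ^ n := by
      simpa using (conj_pow (i := p ^ n) (a := t⁻¹) (b := a)).symm
    rw [pow_succ, pow_succ', pow_mul, ← h, ← h1, ← ih]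
    group

theorem ActsByPowers.natVec {T : Multiplicative (Fin m → ℤ) →* H} {a : H} {p : Fin m → ℕ}
    (h : ActsByPowers T a p) (n : Fin m → ℕ) :
    (T (natVec n))⁻¹ * a * T (natVec n) = a ^ ∏ i, p i ^ n i := by
  have key : ∀ s : Finset (Fin m),
      (T (Multiplicative.ofAdd (∑ i ∈ s, Pi.single i (n i : ℤ))))⁻¹ * a *
        T (Multiplicative.ofAdd (∑ i ∈ s, Pi.single i (n i : ℤ))) = a ^ ∏ i ∈ s, p i ^ n i := by
    intro s
    induction s using Finset.induction_on with
    | empty => simp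
    | insert i s hi ih =>
      rw [Finset.sum_insert hi, Finset.prod_insert hi, ofAdd_add, mul_comm, map_mul, pow_mul,
        map_single_eq_zpow, zpow_natCast, ← conj_pow_of_conj_eq_pow (h i)]
      have h1 : ∀ x y b : H, (x * y)⁻¹ * b * (x * y) = y⁻¹ * (x⁻¹ * b * x) * y := by
        intro x y b; group
      rw [h1, ih]
      have h2 := conj_pow (i := ∏ i ∈ s, p i ^ n i)
        (a := (T (Multiplicative.ofAdd (Pi.single i 1)) ^ n i)⁻¹) (b := a)
      rw [inv_inv] at h2
      exact h2.symm
  have := key Finset.univ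
  rwa [Finset.univ_sum_single] at this

theorem ActsByPowers.zpow_mul_natVec {T : Multiplicative (Fin m → ℤ) →* H} {a : H} {p : Fin m → ℕ}
    (h : ActsByPowers T a p) (n : Fin m → ℕ) (k : ℤ) :
    a ^ k * T (Untame.natVec n) = T (Untame.natVec n) * a ^ ((∏ i, p i ^ n i : ℕ) * k) := by
  rw [zpow_mul, zpow_natCast, ← h.natVec n]
  have h2 := conj_zpow (i := k) (a := (T (Untame.natVec n))⁻¹) (b := a)
  rw [inv_inv] at h2
  rw [h2]
  group

theorem natVec_div_natVec (v : Multiplicative (Fin m → ℤ)) :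
    v = natVec (fun i => (v.toAdd i).toNat) * (natVec fun i => (-v.toAdd i).toNat)⁻¹ := by
  refine Multiplicative.toAdd.injective (funext fun i => ?_)
  simp only [natVec, toAdd_mul, toAdd_inv, toAdd_ofAdd, Pi.add_apply, Pi.neg_apply]
  omega

/-- Powers of `a` can be moved to the right past `T n`, and to the left past `(T n)⁻¹`, for `n` a
vector of natural numbers. Splitting an integer vector into its positive and negative parts
therefore gathers all powers of `a` in the middle. -/
theorem ActsByPowers.exists_normal_form {T : Multiplicative (Fin m → ℤ) →* H} {a : H}
    {p : Fin m → ℕ} (h : ActsByPowers T a p) {x : H} (hx : x ∈ T.range ⊔ Subgroup.zpowers a) :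
    ∃ (u v : Multiplicative (Fin m → ℤ)) (k : ℤ), x = T u * a ^ k * T v := by
  have hcl : T.range ⊔ Subgroup.zpowers a =
      Subgroup.closure ((T.range : Set H) ∪ (Subgroup.zpowers a : Set H)) := by
    rw [Subgroup.closure_union, Subgroup.closure_eq, Subgroup.closure_eq]
  have mul_left : ∀ y ∈ ((T.range : Set H) ∪ (Subgroup.zpowers a : Set H)), ∀ x : H,
      (∃ (u v : Multiplicative (Fin m → ℤ)) (k : ℤ), x = T u * a ^ k * T v) →
      ∃ (u v : Multiplicative (Fin m → ℤ)) (k : ℤ), y * x = T u * a ^ k * T v := by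
    rintro y hy _ ⟨u, v, k, rfl⟩
    rcases hy with ⟨w, rfl⟩ | ⟨l, rfl⟩
    · exact ⟨w * u, v, k, by rw [map_mul]; group⟩
    · set n₁ : Fin m → ℕ := fun i => (u.toAdd i).toNat with hn₁
      set n₂ : Fin m → ℕ := fun i => (-u.toAdd i).toNat with hn₂
      refine ⟨Untame.natVec n₁, (Untame.natVec n₂)⁻¹ * v,
        (∏ i, p i ^ n₁ i : ℕ) * l + (∏ i, p i ^ n₂ i : ℕ) * k, ?_⟩
      have h₁ := h.zpow_mul_natVec n₁ l
      have h₂ := h.zpow_mul_natVec n₂ k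
      have h₃ : (T (Untame.natVec n₂))⁻¹ * a ^ k =
          a ^ ((∏ i, p i ^ n₂ i : ℕ) * k) * (T (Untame.natVec n₂))⁻¹ := by
        rw [inv_mul_eq_iff_eq_mul, ← mul_assoc, eq_mul_inv_iff_mul_eq]
        exact h₂
      conv_lhs => rw [natVec_div_natVec u]
      rw [map_mul, map_mul, map_inv, zpow_add]
      change a ^ l * (T (Untame.natVec n₁) * (T (Untame.natVec n₂))⁻¹ * a ^ k * T v) = _
      rw [mul_assoc (T (Untame.natVec n₁)), h₃]
      simp only [← mul_assoc]
      rw [h₁]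
  rw [hcl] at hx
  induction hx using Subgroup.closure_induction_left with
  | one => exact ⟨1, 1, 0, by simp⟩
  | mul_left y hy x _ ih => exact mul_left y hy x ih
  | inv_mul_cancel y hy x _ ih =>
    refine mul_left y⁻¹ ?_ x ih
    rcases hy with hy | hy
    · exact Or.inl (T.range.inv_mem hy)
    · exact Or.inr ((Subgroup.zpowers a).inv_mem hy)

theorem zpow_eq_one_iff_of_not_isOfFinOrder {a : H} (ha : ¬ IsOfFinOrder a) {k : ℤ} :
    a ^ k = 1 ↔ k = 0 := by
  rw [← orderOf_dvd_iff_zpow_eq_one, orderOf_eq_zero ha]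
  simp

/-- If `m > 0`, then `a ^ k = T w` commutes with the first basis element, whose conjugation
multiplies `k` by `p 0 ≥ 2`. -/
theorem ActsByPowers.eq_zero_of_zpow_eq {T : Multiplicative (Fin m → ℤ) →* H} {a : H}
    {p : Fin m → ℕ} (h : ActsByPowers T a p) (ha : ¬ IsOfFinOrder a) (hp : ∀ i, 2 ≤ p i)
    {k : ℤ} {w : Multiplicative (Fin m → ℤ)} (hk : a ^ k = T w) : k = 0 := by
  cases m with
  | zero =>
    have : w = 1 := Multiplicative.toAdd.injective (funext fun i => i.elim0)
    rwa [this, map_one, zpow_eq_one_iff_of_not_isOfFinOrder ha] at hk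
  | succ m =>
    have h1 := conj_zpow (i := k) (a := (T (Multiplicative.ofAdd (Pi.single 0 1)))⁻¹) (b := a)
    have h2 : (T (Multiplicative.ofAdd (Pi.single 0 1)))⁻¹ * a ^ k *
        T (Multiplicative.ofAdd (Pi.single 0 1)) = a ^ k := by
      rw [hk, mul_assoc, ← map_mul, mul_comm w, map_mul, inv_mul_cancel_left]
    rw [inv_inv, h2, h 0, ← zpow_natCast, ← zpow_mul', ← mul_inv_eq_one, ← zpow_neg,
      ← zpow_add, zpow_eq_one_iff_of_not_isOfFinOrder ha] at h1
    have h3 : ((p 0 : ℤ) - 1) * k = 0 := by linarith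
    rcases mul_eq_zero.1 h3 with h4 | h4
    · have := hp 0
      omega
    · exact h4

theorem factorization_prod_pow {p : Fin m → ℕ} (hp : ∀ i, (p i).Prime)
    (hinj : Function.Injective p) (n : Fin m → ℕ) (j : Fin m) :
    (∏ i, p i ^ n i).factorization (p j) = n j := by
  rw [Nat.factorization_prod fun i _ => pow_ne_zero _ (hp i).ne_zero, Finsupp.finsetSum_apply,
    Finset.sum_eq_single j]
  · rw [(hp j).factorization_pow, Finsupp.single_eq_same]
  · intro i _ hi
    rw [(hp i).factorization_pow, Finsupp.single_eq_of_ne]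
    exact fun hc => hi (hinj hc.symm)
  · simp

/-- If `T v = 1`, the positive and negative parts of `v` raise `a` to the same power, and unique
factorization gives `v = 0`. -/
theorem ActsByPowers.freeModulo {T : Multiplicative (Fin m → ℤ) →* H} {a : H}
    {p : Fin m → ℕ} (h : ActsByPowers T a p) (ha : ¬ IsOfFinOrder a) (hp : ∀ i, (p i).Prime)
    (hinj : Function.Injective p) : FreeModulo 0 T := by
  intro v
  simp only [Nat.cast_zero, zero_dvd_iff]
  constructor
  · intro hv
    rw [natVec_div_natVec (Multiplicative.ofAdd v), map_mul, map_inv, mul_inv_eq_one] at hv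
    have h1 := h.natVec fun i => (v i).toNat
    have h2 := h.natVec fun i => (-v i).toNat
    simp only [toAdd_ofAdd] at hv
    rw [hv, h2] at h1
    have h3 := injective_pow_iff_not_isOfFinOrder.2 ha h1
    intro i
    have h4 := factorization_prod_pow hp hinj (fun i => (v i).toNat) i
    rw [← h3, factorization_prod_pow hp hinj] at h4
    omega
  · intro hv
    rw [show v = 0 from funext hv, ofAdd_zero, map_one]

end Tower

variable {G : Type*} [Group G]

/-- The graph is generated by the pairs `(T v, T v)` and `(a, a ^ q)`, so it has the same normal
form. If one entry of a pair is trivial, its power of `a` has exponent `0`, and the two entries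
agree. -/
theorem ActsByPowers.exists_conj (hG : InnerUltrahomogeneous G) {m : ℕ}
    {T : Multiplicative (Fin m → ℤ) →* G} {a : G} {p : Fin m → ℕ} (h : ActsByPowers T a p)
    (ha : ¬ IsOfFinOrder a) (hp : ∀ i, 2 ≤ p i) {q : ℕ} (hq : 2 ≤ q) :
    ∃ t : G, (∀ v, Commute (T v) t) ∧ t⁻¹ * a * t = a ^ q := by
  have hR : ActsByPowers (T.prod T) (a, a ^ q) p := by
    intro i
    refine Prod.ext (h i) ?_
    have h1 := conj_pow (i := q) (a := (T (Multiplicative.ofAdd (Pi.single i 1)))⁻¹) (b := a)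
    rw [inv_inv, h i, ← pow_mul, mul_comm, pow_mul] at h1
    exact h1.symm
  have hform : ∀ x y, (x, y) ∈ (T.prod T).range ⊔ Subgroup.zpowers (a, a ^ q) →
      ∃ (u v : Multiplicative (Fin m → ℤ)) (k : ℤ), x = T u * a ^ k * T v ∧
        y = T u * a ^ (q * k) * T v := by
    intro x y hxy
    obtain ⟨u, v, k, huv⟩ := hR.exists_normal_form hxy
    refine ⟨u, v, k, congrArg Prod.fst huv, ?_⟩
    rw [zpow_mul, zpow_natCast]
    exact congrArg Prod.snd huv
  have hinj : ∀ (u v : Multiplicative (Fin m → ℤ)) (k : ℤ), T u * a ^ k * T v = 1 → k = 0 := by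
    intro u v k hk
    refine h.eq_zero_of_zpow_eq ha hp (w := u⁻¹ * v⁻¹) ?_
    rw [map_mul, map_inv, map_inv, eq_inv_mul_iff_mul_eq, eq_inv_iff_mul_eq_one]
    exact hk
  obtain ⟨t, ht⟩ := hG.exists_conj_of_graph ((T.prod T).range ⊔ Subgroup.zpowers (a, a ^ q))
    (((Group.fg_iff_subgroup_fg _).1 (Group.fg_range _)).sup
      ⟨{(a, a ^ q)}, by simp [Subgroup.zpowers_eq_closure]⟩)
    (by
      intro x hx
      obtain ⟨u, v, k, rfl, h2⟩ := hform _ _ hx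
      have hk := hinj _ _ _ h2.symm
      have hk' : k = 0 := by
        rcases mul_eq_zero.1 hk with h | h
        · omega
        · exact h
      rw [h2, hk, hk'])
    (by
      intro x hx
      obtain ⟨u, v, k, h2, rfl⟩ := hform _ _ hx
      have hk := hinj _ _ _ h2.symm
      rw [h2, hk, mul_zero])
  refine ⟨t, fun v => commute_iff_conj_eq.2 (ht _ _ ?_), ht _ _ ?_⟩
  · exact Subgroup.mem_sup_left ⟨v, rfl⟩
  · exact Subgroup.mem_sup_right (Subgroup.mem_zpowers _)

theorem exists_actsByPowers (hG : InnerUltrahomogeneous G) {a : G} (ha : ¬ IsOfFinOrder a)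
    {m : ℕ} (p : Fin m → ℕ) (hp : ∀ i, 2 ≤ p i) :
    ∃ T : Multiplicative (Fin m → ℤ) →* G, ActsByPowers T a p := by
  induction m with
  | zero => exact ⟨1, fun i => i.elim0⟩
  | succ m ih =>
    obtain ⟨T, hT⟩ := ih (fun i => p i.succ) (fun i => hp _)
    obtain ⟨t, ht₁, ht₂⟩ := hT.exists_conj hG ha (fun i => hp _) (hp 0)
    refine ⟨extendHom T t ht₁, fun i => ?_⟩
    rw [extendHom_ofAdd]
    refine Fin.cases ?_ (fun j => ?_) i
    · have : Fin.tail (Pi.single 0 1 : Fin (m + 1) → ℤ) = 0 := by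
        ext j; simp [Fin.tail]
      rw [this]
      simpa using ht₂
    · have : Fin.tail (Pi.single j.succ 1 : Fin (m + 1) → ℤ) = Pi.single j 1 := by
        ext j'; simp [Fin.tail, Pi.single_apply]
      rw [this]
      simpa using hT j

theorem exists_freeModulo_zero (hG : InnerUltrahomogeneous G) {a : G} (ha : ¬ IsOfFinOrder a)
    (m : ℕ) : ∃ E : Multiplicative (Fin m → ℤ) →* G, FreeModulo 0 E := by
  have hp : ∀ i : Fin m, (Nat.nth Nat.Prime i).Prime := fun i => Nat.prime_nth_prime i
  obtain ⟨T, hT⟩ := exists_actsByPowers hG ha (fun i : Fin m => Nat.nth Nat.Prime i)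
    (fun i => (hp i).two_le)
  exact ⟨T, hT.freeModulo ha hp fun i j hij =>
    Fin.ext (Nat.nth_injective Nat.infinite_setOfPred_prime hij)⟩

theorem hasLargeFree_of_not_torsion (hG : InnerUltrahomogeneous G) {a : G}
    (ha : ¬ IsOfFinOrder a) : HasLargeFree G := fun m => by
  obtain ⟨E, hE⟩ := exists_freeModulo_zero hG ha m
  exact ⟨0, E, hE, by norm_num, by norm_num⟩

/-- Multiplication of `F`, precomposed with the scalar `N`, by powers of a commuting element. -/
def shiftHom {ι : Type*} [Fintype ι] (F : Multiplicative (ι → ℤ) →* G) (s : G)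
    (hs : ∀ v, Commute (F v) s) (N : ℤ) : Multiplicative (ι → ℤ) →* G where
  toFun v := F (Multiplicative.ofAdd (N • v.toAdd)) * s ^ (∑ i, v.toAdd i)
  map_one' := by simp
  map_mul' v w := by
    have h1 : ∑ i, (v * w).toAdd i = ∑ i, v.toAdd i + ∑ i, w.toAdd i := by
      rw [toAdd_mul, ← Finset.sum_add_distrib]; rfl
    rw [h1, toAdd_mul, smul_add, ofAdd_add, map_mul, zpow_add]
    have h := ((hs (Multiplicative.ofAdd (N • w.toAdd))).zpow_right (∑ i, v.toAdd i)).eq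
    simp only [mul_assoc]
    rw [← mul_assoc (s ^ _) (F _), ← h]
    simp only [mul_assoc]

theorem shiftHom_ofAdd {ι : Type*} [Fintype ι] (F : Multiplicative (ι → ℤ) →* G) (s : G)
    (hs : ∀ v, Commute (F v) s) (N : ℤ) (v : ι → ℤ) :
    shiftHom F s hs N (Multiplicative.ofAdd v) =
      F (Multiplicative.ofAdd (N • v)) * s ^ (∑ i, v i) := rfl

/-- One of `N = 1, 2` works. Relations `v` for `1` and `w` for `2` give, on eliminating `s`, `(∑ w)
v = (∑ v) 2w`. Summing coordinates shows that `∑ v` or `∑ w` is zero, and then `F` kills `v` or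
`2w`. -/
theorem FreeModulo.exists_shiftHom {ι : Type*} [Fintype ι] {F : Multiplicative (ι → ℤ) →* G}
    (hF : FreeModulo 0 F) (s : G) (hs : ∀ v, Commute (F v) s) :
    ∃ N : ℤ, FreeModulo 0 (shiftHom F s hs N) := by
  have hF' : ∀ v : ι → ℤ, F (Multiplicative.ofAdd v) = 1 → v = 0 := fun v hv => by
    have := (hF v).1 hv
    exact funext fun i => by simpa using this i
  have red : ∀ N : ℤ, ¬ FreeModulo 0 (shiftHom F s hs N) →
      ∃ v : ι → ℤ, v ≠ 0 ∧ F (Multiplicative.ofAdd (N • v)) = s ^ (-∑ i, v i) := by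
    intro N hN
    by_contra! hcon
    refine hN fun v => ⟨fun hv => ?_, fun hv => ?_⟩
    · have : v = 0 := by
        by_contra hv0
        refine hcon v hv0 ?_
        rw [zpow_neg]
        exact eq_inv_of_mul_eq_one_left hv
      simp [this]
    · have : v = 0 := funext fun i => by simpa using hv i
      rw [this, ofAdd_zero, map_one]
  by_contra! hcon
  obtain ⟨v, hv0, hv⟩ := red 1 (hcon 1)
  obtain ⟨w, hw0, hw⟩ := red 2 (hcon 2)
  rw [one_smul] at hv
  have h1 : F (Multiplicative.ofAdd ((∑ i, w i) • v - (∑ i, v i) • ((2 : ℤ) • w))) = 1 := by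
    rw [ofAdd_sub, map_div, ofAdd_zsmul, ofAdd_zsmul, map_zpow, map_zpow, hv, hw, div_eq_one,
      ← zpow_mul, ← zpow_mul]
    congr 1
    ring
  have h2 := hF' _ h1
  have h3 : ∑ i, ((∑ i, w i) • v - (∑ i, v i) • ((2 : ℤ) • w)) i = 0 := by rw [h2]; simp
  simp only [Pi.sub_apply, Pi.smul_apply, smul_eq_mul, Finset.sum_sub_distrib,
    ← Finset.mul_sum] at h3
  have h4 : (∑ i, w i) * ∑ i, v i = 0 := by linarith
  rcases mul_eq_zero.1 h4 with h | h
  · rw [h, neg_zero, zpow_zero] at hw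
    have := hF' _ hw
    exact hw0 ((smul_eq_zero.1 this).resolve_left (by norm_num))
  · rw [h, neg_zero, zpow_zero] at hv
    exact hv0 (hF' _ hv)

/-- Let `s` invert one basis element `w` and centralize the others. The elements `F(N eᵢ) s` do not
commute with `w`, but their squares do, and `N` can be chosen to make them independent. Conjugating
them simultaneously to their `2 ^ f i`-th powers moves this jump to level `f i`. -/
theorem hasCentralizerChains_of_not_torsion (hG : InnerUltrahomogeneous G) {a : G}
    (ha : ¬ IsOfFinOrder a) : HasCentralizerChains G := by
  intro k
  obtain ⟨E, hE⟩ := exists_freeModulo_zero hG ha (k + 1)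
  set w := E (Multiplicative.ofAdd (Pi.single 0 1)) with hw
  obtain ⟨s, hs⟩ := hE.exists_conj_linear hG
    (diagHom fun i : Fin (k + 1) => if i = 0 then (-1 : ℤ) else 1)
    (fun v => forall_congr' fun i => by
      rw [diagHom_apply]
      split_ifs <;> simp)
  let M : (Fin k → ℤ) →+ (Fin (k + 1) → ℤ) :=
    { toFun := fun v => Fin.cons 0 v
      map_zero' := by ext i; refine Fin.cases ?_ (fun j => ?_) i <;> simp
      map_add' := fun v w => by ext i; refine Fin.cases ?_ (fun j => ?_) i <;> simp }
  set F := E.comp (AddMonoidHom.toMultiplicative M) with hFdef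
  have hFE : ∀ v : Fin k → ℤ, F (Multiplicative.ofAdd v) =
      E (Multiplicative.ofAdd (Fin.cons 0 v : Fin (k + 1) → ℤ)) := fun _ => rfl
  have hF : FreeModulo 0 F := by
    intro v
    rw [hFE, hE, Fin.forall_fin_succ]
    simp
  have hsF : ∀ v, Commute (F v) s := by
    intro v
    rw [← ofAdd_toAdd v, hFE, commute_iff_conj_eq, hs]
    congr 2
    ext i
    refine Fin.cases ?_ (fun j => ?_) i <;> simp
  have hsw : s⁻¹ * w * s = w⁻¹ := by
    rw [hw, hs, ← map_inv, ← ofAdd_neg, ← Pi.single_neg]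
    congr 2
    ext i
    refine Fin.cases ?_ (fun j => ?_) i <;> simp
  have hwF : ∀ v, Commute w (F v) := by
    intro v
    rw [← ofAdd_toAdd v, hFE]
    exact (Commute.all _ _).map E
  have hw2 : w⁻¹ ≠ w := by
    intro hc
    rw [inv_eq_iff_mul_eq_one, ← pow_two, ← zpow_natCast, hw, ← map_single_eq_zpow,
      hE.single_eq_one_iff] at hc
    norm_num at hc
  obtain ⟨N, hN⟩ := hF.exists_shiftHom s hsF
  set S := shiftHom F s hsF N with hS
  have hS1 : ∀ i, S (Multiplicative.ofAdd (Pi.single i 1)) =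
      F (Multiplicative.ofAdd (N • Pi.single i 1)) * s := by
    intro i
    rw [hS, shiftHom_ofAdd]
    simp
  refine ⟨fun i => S (Multiplicative.ofAdd (Pi.single i 1)), 2, fun f _ => ?_⟩
  obtain ⟨g, hg⟩ := hN.exists_conj_linear hG (diagHom fun i => (2 : ℤ) ^ f i)
    (fun v => forall_congr' fun i => by simp)
  have hg1 : ∀ i, S (Multiplicative.ofAdd (Pi.single i 1)) ^ 2 ^ f i =
      g⁻¹ * S (Multiplicative.ofAdd (Pi.single i 1)) * g := by
    intro i
    rw [hg, ← zpow_natCast, ← map_single_eq_zpow]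
    congr 2
    ext j
    by_cases hj : j = i
    · subst hj; simp
    · simp [hj]
  have hcomm : ∀ {x y : G}, Commute (g⁻¹ * x * g) (g⁻¹ * y * g) ↔ Commute x y := by
    intro x y
    have := Commute.conj_iff (a := x) (b := y) g⁻¹
    rwa [inv_inv] at this
  refine ⟨g⁻¹ * w * g, fun i => ⟨?_, ?_⟩⟩
  · rw [pow_succ, pow_mul, hg1]
    have h1 := conj_pow (i := 2) (a := g⁻¹) (b := S (Multiplicative.ofAdd (Pi.single i 1)))
    rw [inv_inv] at h1
    rw [h1, hcomm, hS1, (hsF _).mul_pow]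
    refine ((hwF _).pow_right 2).mul_right ?_
    rw [commute_iff_conj_eq, pow_two]
    have h2 : ∀ x : G, (s * s)⁻¹ * x * (s * s) = s⁻¹ * (s⁻¹ * x * s) * s := fun x => by group
    rw [h2, hsw]
    have h3 : s⁻¹ * w⁻¹ * s = (s⁻¹ * w * s)⁻¹ := by group
    rw [h3, hsw, inv_inv]
  · rw [hg1, hcomm, hS1]
    intro hc
    have h1 : Commute w s := by
      have := ((hwF (Multiplicative.ofAdd (N • Pi.single i 1))).inv_right).mul_right hc
      rwa [inv_mul_cancel_left] at this
    rw [commute_iff_conj_eq, hsw] at h1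
    exact hw2 h1

end Untame

/-! ### Transvections of an abelian `q`-subgroup of maximal order -/

namespace Untame

variable {G : Type*} [Group G]

/-- Commutative finite `q`-subgroups. -/
structure IsAbelianPSubgroup (q : ℕ) (B : Subgroup G) : Prop where
  comm : ∀ x ∈ B, ∀ y ∈ B, x * y = y * x
  finite : Finite B
  isPGroup : IsPGroup q B

theorem isAbelianPSubgroup_range {A : Type*} [CommGroup A] [Finite A] {q : ℕ} (hA : IsPGroup q A)
    (j : A →* G) : IsAbelianPSubgroup q j.range where
  comm := by
    rintro _ ⟨x, rfl⟩ _ ⟨y, rfl⟩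
    rw [← map_mul, ← map_mul, mul_comm]
  finite := Set.finite_range j
  isPGroup := hA.of_surjective j.rangeRestrict j.rangeRestrict_surjective

/-- The homomorphism from `ℤ/n` to the powers of `x`, where `x ^ n = 1`. -/
def zmodHom (x : G) (n : ℕ) (hx : x ^ n = 1) : Multiplicative (ZMod n) →* G :=
  AddMonoidHom.toMultiplicativeLeft
    (ZMod.lift n ⟨zmultiplesHom (Additive G) (Additive.ofMul x), by
      rw [zmultiplesHom_apply, natCast_zsmul, ← ofMul_pow, hx, ofMul_one]⟩)

theorem zmodHom_intCast (x : G) (n : ℕ) (hx : x ^ n = 1) (i : ℤ) :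
    zmodHom x n hx (Multiplicative.ofAdd (i : ZMod n)) = x ^ i := by
  simp [zmodHom]

theorem exists_zmodHom_eq (x : G) (n : ℕ) (hx : x ^ n = 1) (a : Multiplicative (ZMod n)) :
    ∃ i : ℤ, a = Multiplicative.ofAdd (i : ZMod n) ∧ zmodHom x n hx a = x ^ i := by
  obtain ⟨i, hi⟩ := ZMod.intCast_surjective a.toAdd
  refine ⟨i, ?_, ?_⟩
  · rw [hi, ofAdd_toAdd]
  · rw [← zmodHom_intCast x n hx, hi, ofAdd_toAdd]

/-- The homomorphism from `A × ℤ/n` given by `j` and an element commuting with its values. -/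
def adjoin {A : Type*} [CommGroup A] (j : A →* G) (x : G) (n : ℕ) (hx : x ^ n = 1)
    (hc : ∀ a, Commute (j a) x) : A × Multiplicative (ZMod n) →* G :=
  MonoidHom.noncommCoprod j (zmodHom x n hx) fun a b => by
    obtain ⟨i, -, hi⟩ := exists_zmodHom_eq x n hx b
    rw [hi]
    exact (hc a).zpow_right i

theorem isPGroup_prod_zmod {A : Type*} [CommGroup A] {q : ℕ} (hA : IsPGroup q A) (k : ℕ) :
    IsPGroup q (A × Multiplicative (ZMod (q ^ k))) := by
  rintro ⟨a, b⟩
  obtain ⟨l, hl⟩ := hA a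
  refine ⟨l + k, Prod.ext ?_ ?_⟩
  · rw [Prod.pow_fst, pow_add, pow_mul, hl, one_pow]; rfl
  · rw [Prod.pow_snd, add_comm, pow_add, pow_mul]
    have : b ^ q ^ k = 1 := by
      refine Multiplicative.toAdd.injective ?_
      rw [toAdd_pow, toAdd_one, nsmul_eq_mul, CharP.cast_eq_zero, zero_mul]
    rw [this, one_pow]; rfl

/-- An element of `q`-power order commuting with a commutative finite `q`-subgroup of maximal order
belongs to it. -/
theorem mem_range_of_commute {A : Type*} [CommGroup A] [Finite A] {q : ℕ} (hq : q.Prime)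
    (hA : IsPGroup q A)
    {j : A →* G} (hj : Function.Injective j)
    (hmax : ∀ B : Subgroup G, IsAbelianPSubgroup q B → Nat.card B ≤ Nat.card A)
    {x : G} (hc : ∀ a, Commute (j a) x) {k : ℕ} (hx : x ^ q ^ k = 1) : x ∈ j.range := by
  have : NeZero (q ^ k) := ⟨pow_ne_zero _ hq.ne_zero⟩
  have : Finite (Multiplicative (ZMod (q ^ k))) := inferInstanceAs (Finite (ZMod (q ^ k)))
  have hB := isAbelianPSubgroup_range (isPGroup_prod_zmod hA k) (adjoin j x _ hx hc)
  have hle : j.range ≤ (adjoin j x _ hx hc).range := by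
    rintro _ ⟨a, rfl⟩
    exact ⟨(a, 1), by simp [adjoin]⟩
  have hcard : Nat.card j.range = Nat.card A :=
    (Nat.card_congr (MonoidHom.ofInjective hj).toEquiv).symm
  have := hB.finite
  rw [Subgroup.eq_of_le_of_card_ge hle (hcard ▸ hmax _ hB)]
  refine ⟨(1, Multiplicative.ofAdd ((1 : ℤ) : ZMod (q ^ k))), ?_⟩
  rw [adjoin, MonoidHom.noncommCoprod_apply, map_one, one_mul, zmodHom_intCast, zpow_one]

/-- Every element of finite order has a power of `q`-power order, with exponent `1` modulo `q`. -/
theorem exists_pow_qpart {q : ℕ} (hq : q.Prime) {g : G} (hg : IsOfFinOrder g) :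
    ∃ l k : ℕ, (g ^ (1 + q * l)) ^ q ^ k = 1 := by
  obtain ⟨k, u, hu, hn⟩ := Nat.exists_eq_pow_mul_and_not_dvd hg.orderOf_pos.ne' q hq.ne_one
  have hco : Nat.Coprime q u := (Nat.Prime.coprime_iff_not_dvd hq).2 hu
  -- The exponent is `1` modulo `q` and a multiple of the prime-to-`q` part `u` of the order.
  obtain ⟨c, hc1, hc2⟩ := Nat.chineseRemainder hco 1 0
  have h1 : c % q = 1 := by
    rw [hc1]; exact Nat.mod_eq_of_lt hq.one_lt
  have h2 : u ∣ c := (Nat.modEq_zero_iff_dvd).1 hc2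
  refine ⟨c / q, k, ?_⟩
  have h3 : 1 + q * (c / q) = c := by
    conv_rhs => rw [← Nat.mod_add_div c q, h1]
  rw [h3, ← pow_mul, ← orderOf_dvd_iff_pow_eq_one, hn, mul_comm]
  exact Nat.mul_dvd_mul_right h2 _

section Transvection

variable {A : Type*} [CommGroup A] {j : A →* G} {χ : A →* A} {g : G}

theorem conj_pow_transvection (hχ : ∀ a, χ (χ a) = 1)
    (hg : ∀ a, g⁻¹ * j a * g = j (a * χ a)) (n : ℕ) (a : A) :
    (g ^ n)⁻¹ * j a * g ^ n = j (a * χ a ^ n) := by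
  induction n generalizing a with
  | zero => simp
  | succ n ih =>
    have : (g ^ (n + 1))⁻¹ * j a * g ^ (n + 1) = g⁻¹ * ((g ^ n)⁻¹ * j a * g ^ n) * g := by
      rw [pow_succ]; group
    rw [this, ih, hg, map_mul χ, map_pow, hχ, one_pow, mul_one, pow_succ, mul_assoc,
      mul_comm (χ a ^ n)]

/-- Collecting the factors `g` on the left applies the transvection `i` times to the factors `b`,
for `i = 0, …, n - 1`. At `n = q` the resulting factor is the norm of `b`. -/
theorem mul_pow_transvection (hχ : ∀ a, χ (χ a) = 1)
    (hg : ∀ a, g⁻¹ * j a * g = j (a * χ a)) (b : A) (n : ℕ) :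
    (g * j b) ^ n = g ^ n * j (b ^ n * χ b ^ ∑ i ∈ Finset.range n, i) := by
  induction n with
  | zero => simp
  | succ n ih =>
    have h1 : ∀ a, j a * g = g * j (a * χ a) := fun a => by rw [← hg]; group
    have h2 : b ^ n * χ b ^ (∑ i ∈ Finset.range n, i) *
        χ (b ^ n * χ b ^ (∑ i ∈ Finset.range n, i)) * b =
        b ^ (n + 1) * χ b ^ ∑ i ∈ Finset.range (n + 1), i := by
      simp only [map_mul, map_pow, hχ, one_pow, mul_one, Finset.sum_range_succ, pow_add, pow_one]
      ac_rfl
    rw [← h2, pow_succ (g * j b), ih, mul_assoc, ← mul_assoc (j _) g, h1, map_mul j _ b, pow_succ g]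
    simp only [mul_assoc]

/-- As `χ` squares to the trivial map, `a ↦ a χ(a)` is injective. Passing to a power of the
conjugator with exponent `1` modulo `q` keeps the action, because `χ ^ q` is trivial. -/
theorem exists_transvection [Finite A] (hG : InnerUltrahomogeneous G)
    (htors : ∀ g : G, IsOfFinOrder g) {q : ℕ} (hq : q.Prime)
    (hj : Function.Injective j) (hχ : ∀ a, χ (χ a) = 1) (hχq : ∀ a, χ a ^ q = 1) :
    ∃ (g : G) (k : ℕ), (∀ a, g⁻¹ * j a * g = j (a * χ a)) ∧ g ^ q ^ k = 1 := by
  let α : A →* A := MonoidHom.id A * χ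
  have hα : ∀ a, α a = a * χ a := fun a => rfl
  have hα1 : ∀ a, α a = 1 → a = 1 := by
    intro a ha
    have h1 : χ (a * χ a) = 1 := by rw [← hα, ha, map_one]
    rw [map_mul, hχ, mul_one] at h1
    rwa [hα, h1, mul_one] at ha
  obtain ⟨g, hg⟩ := hG.exists_conj_of_graph (j.prod (j.comp α)).range
    ((Group.fg_iff_subgroup_fg _).1 (Group.fg_range _))
    (by
      rintro x ⟨a, ha⟩
      have h1 : j a = x := congrArg Prod.fst ha
      have h2 : j (α a) = 1 := congrArg Prod.snd ha
      rw [← h1, hα1 a ((injective_iff_map_eq_one j).1 hj _ h2), map_one])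
    (by
      rintro x ⟨a, ha⟩
      have h1 : j a = 1 := congrArg Prod.fst ha
      have h2 : j (α a) = x := congrArg Prod.snd ha
      rw [← h2, (injective_iff_map_eq_one j).1 hj _ h1, map_one, map_one])
  have hg' : ∀ a, g⁻¹ * j a * g = j (a * χ a) := fun a => hg _ _ ⟨a, rfl⟩
  obtain ⟨l, k, hl⟩ := exists_pow_qpart hq (htors g)
  refine ⟨g ^ (1 + q * l), k, fun a => ?_, hl⟩
  rw [conj_pow_transvection hχ hg', pow_add, pow_mul, hχq, one_pow, mul_one, pow_one]

/-- A power of `g` in the abelian group `A` acts trivially on it, while `χ` takes a value of order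
`q`. -/
theorem dvd_of_zpow_mem_range {q : ℕ} (hq : q.Prime) (hj : Function.Injective j)
    (hχ : ∀ a, χ (χ a) = 1) (hχq : ∀ a, χ a ^ q = 1) (hχ1 : χ ≠ 1)
    (hg : ∀ a, g⁻¹ * j a * g = j (a * χ a)) {n : ℤ} (hn : g ^ n ∈ j.range) : (q : ℤ) ∣ n := by
  have hn' : g ^ n.natAbs ∈ j.range := by
    rcases Int.natAbs_eq n with h | h
    · rw [h, zpow_natCast] at hn; exact hn
    · rw [h, zpow_neg, zpow_natCast, inv_mem_iff] at hn; exact hn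
  obtain ⟨b, hb⟩ := hn'
  obtain ⟨f, hf⟩ : ∃ f, χ f ≠ 1 := by
    by_contra! h
    exact hχ1 (MonoidHom.ext h)
  have h1 := conj_pow_transvection hχ hg n.natAbs f
  rw [← hb, mul_assoc, inv_mul_eq_iff_eq_mul, ← map_mul, ← map_mul, mul_comm b] at h1
  have h2 : χ f ^ n.natAbs = 1 := by
    have := hj h1
    rw [mul_assoc, mul_left_cancel_iff, mul_comm] at this
    exact left_eq_mul.1 this
  have : orderOf (χ f) = q := by
    have := Fact.mk hq
    exact orderOf_eq_prime (hχq f) hf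
  rw [← this]
  exact Int.natCast_dvd.2 (orderOf_dvd_of_pow_eq_one h2)

theorem conj_mul_transvection (hg : ∀ a, g⁻¹ * j a * g = j (a * χ a)) (b a : A) :
    (g * j b)⁻¹ * j a * (g * j b) = j (a * χ a) := by
  have : (g * j b)⁻¹ * j a * (g * j b) = (j b)⁻¹ * (g⁻¹ * j a * g) * j b := by group
  rw [this, hg, mul_assoc, inv_mul_eq_iff_eq_mul, ← map_mul, ← map_mul, mul_comm]

/-- An element of trivial norm gives an automorphism of `⟨A, g⟩` that fixes `A`; when `A` has
maximal order, such an automorphism comes from `A`. -/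
theorem mem_range_of_norm_eq_one [Finite A] (hG : InnerUltrahomogeneous G)
    (htors : ∀ g : G, IsOfFinOrder g) {q : ℕ} (hq : q.Prime) (hA : IsPGroup q A)
    (hj : Function.Injective j)
    (hmax : ∀ B : Subgroup G, IsAbelianPSubgroup q B → Nat.card B ≤ Nat.card A)
    (hχ : ∀ a, χ (χ a) = 1) (hχq : ∀ a, χ a ^ q = 1) (hχ1 : χ ≠ 1)
    (hg : ∀ a, g⁻¹ * j a * g = j (a * χ a)) {b : A}
    (hb : b ^ q * χ b ^ ∑ i ∈ Finset.range q, i = 1) : b ∈ χ.range := by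
  have hgq : (g * j b) ^ q = g ^ q := by
    rw [mul_pow_transvection hχ hg, hb, map_one, mul_one]
  -- The powers of `g` or `g * j b` lying in `A` have exponent divisible by `q`, where the two
  -- agree; so fixing `A` and sending `g` to `g * j b` is consistent.
  have hgq' : ∀ n : ℤ, (q : ℤ) ∣ n → (g * j b) ^ n = g ^ n := by
    rintro _ ⟨n, rfl⟩
    rw [zpow_mul, zpow_mul, zpow_natCast, zpow_natCast, hgq]
  have hg2 := conj_mul_transvection hg b
  have hinv : ∀ a, g * j a * g⁻¹ = j (a * (χ a)⁻¹) := by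
    intro a
    have := hg (a * (χ a)⁻¹)
    rw [map_mul χ, map_inv, hχ, inv_one, mul_one, inv_mul_cancel_right] at this
    rw [← this]; group
  have hinv2 : ∀ a, (g * j b) * j a * (g * j b)⁻¹ = j (a * (χ a)⁻¹) := by
    intro a
    have : (g * j b) * j a * (g * j b)⁻¹ = g * (j b * j a * (j b)⁻¹) * g⁻¹ := by group
    rw [this, ← map_mul, mul_comm, map_mul, mul_inv_cancel_right, hinv]
  have hnf : ∀ x y, (x, y) ∈ (j.prod j).range ⊔ Subgroup.zpowers (g, g * j b) →
      ∃ (a : A) (n : ℤ), x = g ^ n * j a ∧ y = (g * j b) ^ n * j a := by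
    intro x y hxy
    obtain ⟨_, ⟨a, rfl⟩, n, hn⟩ := mul_mem_zpow_form _ _
      (by
        rintro _ ⟨a, rfl⟩
        exact ⟨a * χ a, Prod.ext (hg a).symm (hg2 a).symm⟩)
      (by
        rintro _ ⟨a, rfl⟩
        exact ⟨a * (χ a)⁻¹, Prod.ext (hinv a).symm (hinv2 a).symm⟩) hxy
    exact ⟨a, n, congrArg Prod.fst hn, congrArg Prod.snd hn⟩
  have hmem : ∀ {x : G} {a : A}, x * j a = 1 → x ∈ j.range := by
    intro x a h
    rw [eq_inv_of_mul_eq_one_left h]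
    exact inv_mem ⟨a, rfl⟩
  obtain ⟨h, hh⟩ := hG.exists_conj_of_graph ((j.prod j).range ⊔ Subgroup.zpowers (g, g * j b))
    (((Group.fg_iff_subgroup_fg _).1 (Group.fg_range _)).sup
      ⟨{(g, g * j b)}, by simp [Subgroup.zpowers_eq_closure]⟩)
    (by
      intro x hx
      obtain ⟨a, n, rfl, h2⟩ := hnf _ _ hx
      rw [h2, hgq' n (dvd_of_zpow_mem_range hq hj hχ hχq hχ1 hg2 (hmem h2.symm))])
    (by
      intro x hx
      obtain ⟨a, n, h2, rfl⟩ := hnf _ _ hx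
      rw [h2, hgq' n (dvd_of_zpow_mem_range hq hj hχ hχq hχ1 hg (hmem h2.symm))])
  have hh1 : ∀ a, Commute (j a) h := fun a =>
    commute_iff_conj_eq.2 (hh _ _ (Subgroup.mem_sup_left ⟨a, rfl⟩))
  have hh2 : h⁻¹ * g * h = g * j b := hh _ _ (Subgroup.mem_sup_right (Subgroup.mem_zpowers _))
  have hh3 : ∀ n : ℕ, (h ^ n)⁻¹ * g * h ^ n = g * j (b ^ n) := by
    intro n
    induction n with
    | zero => simp
    | succ n ih =>
      have : (h ^ (n + 1))⁻¹ * g * h ^ (n + 1) = h⁻¹ * ((h ^ n)⁻¹ * g * h ^ n) * h := by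
        rw [pow_succ]; group
      have h4 : h⁻¹ * (g * j (b ^ n)) * h = (h⁻¹ * g * h) * (h⁻¹ * j (b ^ n) * h) := by group
      rw [this, ih, h4, hh2, commute_iff_conj_eq.1 (hh1 _), pow_succ', map_mul, mul_assoc]
  -- By maximality this power of `h` lies in `A`, so it conjugates `g` to `g` times a value of `χ`;
  -- it also conjugates `g` to `g` times `b ^ (1 + q l)`.
  obtain ⟨l, m, hl⟩ := exists_pow_qpart hq (htors h)
  obtain ⟨a, ha⟩ := mem_range_of_commute hq hA hj hmax (fun a => (hh1 a).pow_right (1 + q * l)) hl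
  have h5 := hh3 (1 + q * l)
  rw [← ha] at h5
  have h6 : (j a)⁻¹ * g * j a = g * j (χ a)⁻¹ := by
    have : (j a)⁻¹ * g * j a = g * (g⁻¹ * j a⁻¹ * g * j a) := by rw [map_inv]; group
    rw [this, hg, ← map_mul, map_inv χ, mul_right_comm, inv_mul_cancel, one_mul]
  rw [h6, mul_left_cancel_iff] at h5
  have h7 : b ^ (1 + q * l) ∈ χ.range := by
    rw [← hj h5]
    exact inv_mem ⟨a, rfl⟩
  have h8 : b ^ q ∈ χ.range := by
    rw [eq_inv_of_mul_eq_one_left hb]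
    exact inv_mem (pow_mem (MonoidHom.mem_range.2 ⟨b, rfl⟩) _)
  rw [pow_add, pow_one, pow_mul] at h7
  exact (Subgroup.mul_mem_cancel_right _ (pow_mem h8 l)).1 h7

/-- The transvection is implemented by an element of order `q`. -/
theorem exists_transvection_pow_eq_one [Finite A] (hG : InnerUltrahomogeneous G)
    (htors : ∀ g : G, IsOfFinOrder g) {q : ℕ} (hq : q.Prime) (hA : IsPGroup q A)
    (hj : Function.Injective j)
    (hmax : ∀ B : Subgroup G, IsAbelianPSubgroup q B → Nat.card B ≤ Nat.card A)
    (hχ : ∀ a, χ (χ a) = 1) (hχq : ∀ a, χ a ^ q = 1) (hχ1 : χ ≠ 1) :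
    ∃ g : G, (∀ a, g⁻¹ * j a * g = j (a * χ a)) ∧ g ^ q = 1 := by
  obtain ⟨g, k, hg, hgk⟩ := exists_transvection hG htors hq hj hχ hχq
  let N : A →* A := powMonoidHom q * (powMonoidHom (∑ i ∈ Finset.range q, i)).comp χ
  have hN : ∀ b, N b = b ^ q * χ b ^ ∑ i ∈ Finset.range q, i := fun b => rfl
  have hker : N.ker ≤ χ.range := fun b hb =>
    mem_range_of_norm_eq_one hG htors hq hA hj hmax hχ hχq hχ1 hg hb
  have hran : N.range ≤ χ.ker := by
    rintro _ ⟨b, rfl⟩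
    rw [MonoidHom.mem_ker, hN, map_mul, map_pow, map_pow, hχq, hχ, one_pow, mul_one]
  -- Compare `|ker N| |im N| = |ker χ| |im χ|` with `|ker N| ≤ |im χ|`. Hence every fixed point of
  -- the transvection is a norm.
  have hcard : Nat.card χ.ker ≤ Nat.card N.range := by
    have h1 := N.ker.card_mul_index
    have h2 := χ.ker.card_mul_index
    rw [Subgroup.index_ker] at h1 h2
    have h3 := Subgroup.card_le_of_le hker
    have h4 : 0 < Nat.card χ.range := Nat.card_pos
    rw [← h2, mul_comm] at h1
    by_contra! hlt
    have := Nat.mul_lt_mul_of_lt_of_le hlt h3 h4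
    omega
  have heq := Subgroup.eq_of_le_of_card_ge hran hcard
  obtain ⟨y, hy⟩ := mem_range_of_commute hq hA hj hmax (x := g ^ q) (k := k)
    (fun a => commute_iff_conj_eq.2 (by
      have := conj_pow_transvection hχ hg q a
      rw [hχq, mul_one] at this
      have h1 : (j a)⁻¹ * (g ^ q) * j a = g ^ q := by
        rw [mul_assoc, inv_mul_eq_iff_eq_mul]
        rw [mul_assoc, inv_mul_eq_iff_eq_mul] at this
        exact this.symm
      rw [this]))
    (by rw [← pow_mul, mul_comm, pow_mul, hgk, one_pow])
  -- `g ^ q` is fixed by `g`, so its inverse is a norm `N x`, and `g * j x` has trivial `q`-th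
  -- power.
  have hyker : y⁻¹ ∈ N.range := by
    rw [heq, inv_mem_iff, MonoidHom.mem_ker]
    have h1 : g⁻¹ * j y * g = j y := by rw [hy]; group
    rw [hg] at h1
    exact mul_eq_left.1 (hj h1)
  obtain ⟨x, hx⟩ := hyker
  refine ⟨g * j x, conj_mul_transvection hg x, ?_⟩
  rw [mul_pow_transvection hχ hg, ← hN, hx, ← hy, ← map_mul, mul_inv_cancel, map_one]

end Transvection

/-- A commutative finite `q`-group has an endomorphism onto a given subgroup of order `q`, trivial
on a given proper subgroup. -/
theorem exists_endomorphism {A : Type*} [CommGroup A] [Finite A] {q : ℕ} (hq : q.Prime) {s n : ℕ}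
    (hs : Nat.card A = q ^ (s + 1)) (H : Subgroup A) (hH : Nat.card H = q ^ n) (hn : n ≤ s) {c : A}
    (hc : orderOf c = q) : ∃ χ : A →* A, H ≤ χ.ker ∧ χ.range = Subgroup.zpowers c := by
  have := Fact.mk hq
  -- Enlarge `H` to a subgroup of index `q` and identify the quotient with the powers of `c`.
  obtain ⟨K, hK, hHK⟩ := Sylow.exists_subgroup_card_pow_prime_le q
    (hs ▸ pow_dvd_pow q (Nat.le_succ s)) H hH hn
  have h1 : Nat.card (A ⧸ K) = q := by
    have h2 := K.card_mul_index
    rw [hK, hs, pow_succ] at h2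
    exact Nat.eq_of_mul_eq_mul_left (pow_pos hq.pos _) h2
  let e := mulEquivOfPrimeCardEq h1 ((Nat.card_zpowers c).trans hc)
  refine ⟨(Subgroup.zpowers c).subtype.comp (e.toMonoidHom.comp (QuotientGroup.mk' K)),
    fun x hx => ?_, ?_⟩
  · have : QuotientGroup.mk' K x = 1 := (QuotientGroup.eq_one_iff x).2 (hHK hx)
    rw [MonoidHom.mem_ker, MonoidHom.comp_apply, MonoidHom.comp_apply, this, map_one, map_one]
  · ext x
    constructor
    · rintro ⟨y, rfl⟩
      exact Subtype.prop _
    · intro hx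
      obtain ⟨y, hy⟩ := e.surjective ⟨x, hx⟩
      obtain ⟨z, rfl⟩ := QuotientGroup.mk'_surjective K y
      exact ⟨z, congrArg Subtype.val hy⟩

end Untame

/-! ### Unbounded `q`-power orders from an element of order `q ^ 2` -/

namespace Untame

variable {G : Type*} [Group G]

theorem dvd_sum_range {q : ℕ} (h : q ≠ 2) (hq : q.Prime) : q ∣ ∑ i ∈ Finset.range q, i := by
  have h1 := Finset.sum_range_id_mul_two q
  refine ((Nat.Coprime.dvd_mul_right ?_).1 (h1 ▸ dvd_mul_right q (q - 1)))
  exact (Nat.coprime_primes hq Nat.prime_two).2 h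

/-- The properties of an endomorphism with image generated by an element `c` of order `q` that it
kills. -/
theorem endomorphism_spec {A : Type*} [CommGroup A] {q : ℕ} (hq : q.Prime) {c : A}
    (hc : orderOf c = q) {χ : A →* A} (hχc : c ∈ χ.ker) (hr : χ.range = Subgroup.zpowers c) :
    (∀ a, χ (χ a) = 1) ∧ (∀ a, χ a ^ q = 1) ∧ χ ≠ 1 := by
  have h : ∀ a, ∃ i : ℤ, c ^ i = χ a := fun a => by
    have : χ a ∈ χ.range := ⟨a, rfl⟩
    rwa [hr] at this
  refine ⟨fun a => ?_, fun a => ?_, fun h1 => ?_⟩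
  · obtain ⟨i, hi⟩ := h a
    rw [← hi, map_zpow, MonoidHom.mem_ker.1 hχc, one_zpow]
  · obtain ⟨i, hi⟩ := h a
    rw [← hi, ← zpow_natCast, zpow_comm, zpow_natCast, ← hc, pow_orderOf_eq_one, one_zpow]
  · have h2 : c ∈ χ.range := hr ▸ Subgroup.mem_zpowers c
    obtain ⟨a, ha⟩ := h2
    rw [h1, MonoidHom.one_apply] at ha
    rw [← ha, orderOf_one] at hc
    exact hq.ne_one hc.symm

open scoped Pointwise in
-- Choose `χ` with image `⟨c⟩` that kills `c`, and also `d` if `|A| ≥ q ^ 3`. Then `d` has trivial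
-- norm (for odd `q`, because `q` divides `0 + ⋯ + (q - 1)`), which would put `d` in `⟨c⟩`.
theorem false_of_independent (hG : InnerUltrahomogeneous G) (htors : ∀ g : G, IsOfFinOrder g)
    {q : ℕ} (hq : q.Prime) {A : Type*} [CommGroup A] [Finite A] {j : A →* G}
    (hj : Function.Injective j)
    (hmax : ∀ B : Subgroup G, IsAbelianPSubgroup q B → Nat.card B ≤ Nat.card A) {s : ℕ}
    (hs : Nat.card A = q ^ (s + 1)) (hs1 : 1 ≤ s) (hsq : 2 ≤ s ∨ q ≠ 2) {c d : A}
    (hc : orderOf c = q) (hd : orderOf d = q) (hdc : d ∉ Subgroup.zpowers c) : False := by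
  have := Fact.mk hq
  have hA : IsPGroup q A := IsPGroup.of_card hs
  have hdq : d ^ q = 1 := by rw [← hd, pow_orderOf_eq_one]
  have key : ∀ χ : A →* A, c ∈ χ.ker → χ.range = Subgroup.zpowers c →
      χ d ^ ∑ i ∈ Finset.range q, i = 1 → False := by
    intro χ h1 h2 h3
    obtain ⟨hχ, hχq, hχ1⟩ := endomorphism_spec hq hc h1 h2
    obtain ⟨g, k, hg, -⟩ := exists_transvection hG htors hq hj hχ hχq
    have := mem_range_of_norm_eq_one hG htors hq hA hj hmax hχ hχq hχ1 hg (b := d)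
      (by rw [h3, hdq, one_mul])
    rw [h2] at this
    exact hdc this
  rcases hsq with hs2 | hq2
  · set H := Subgroup.zpowers c ⊔ Subgroup.zpowers d with hH
    obtain ⟨n, hn⟩ := IsPGroup.iff_card.1 (hA.to_subgroup H)
    have hle : Nat.card H ≤ q ^ 2 := by
      have h1 : (H : Set A) = (Subgroup.zpowers c : Set A) * (Subgroup.zpowers d : Set A) :=
        Subgroup.mul_normal _ _
      have h2 := Set.natCard_mul_le (s := (Subgroup.zpowers c : Set A))
        (t := (Subgroup.zpowers d : Set A))
      rw [← h1] at h2
      have h3 : Nat.card (Subgroup.zpowers c) = q := (Nat.card_zpowers c).trans hc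
      have h4 : Nat.card (Subgroup.zpowers d) = q := (Nat.card_zpowers d).trans hd
      calc Nat.card H ≤ Nat.card (Subgroup.zpowers c) * Nat.card (Subgroup.zpowers d) := h2
        _ = q ^ 2 := by rw [h3, h4, pow_two]
    have hn2 : n ≤ s := by
      rw [hn] at hle
      exact ((Nat.pow_le_pow_iff_right hq.one_lt).1 hle).trans hs2
    obtain ⟨χ, h1, h2⟩ := exists_endomorphism hq hs H hn hn2 hc
    refine key χ (h1 (Subgroup.mem_sup_left (Subgroup.mem_zpowers c))) h2 ?_
    rw [MonoidHom.mem_ker.1 (h1 (Subgroup.mem_sup_right (Subgroup.mem_zpowers d))), one_pow]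
  · obtain ⟨χ, h1, h2⟩ := exists_endomorphism hq hs (Subgroup.zpowers c) (n := 1)
      (by rw [Nat.card_zpowers, hc, pow_one]) hs1 hc
    refine key χ (h1 (Subgroup.mem_zpowers c)) h2 ?_
    obtain ⟨l, hl⟩ := dvd_sum_range hq2 hq
    rw [hl, pow_mul, (endomorphism_spec hq hc (h1 (Subgroup.mem_zpowers c)) h2).2.1, one_pow]

/-- Replace `A` by `ker χ × ⟨g⟩`, where `g` is a transvection of order `q`. It has the same order,
and it contains the independent elements `c` and `g`. -/
theorem false_of_max (hG : InnerUltrahomogeneous G) (htors : ∀ g : G, IsOfFinOrder g)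
    {q : ℕ} (hq : q.Prime) {A : Type*} [CommGroup A] [Finite A] {j : A →* G}
    (hj : Function.Injective j)
    (hmax : ∀ B : Subgroup G, IsAbelianPSubgroup q B → Nat.card B ≤ Nat.card A) {s : ℕ}
    (hs : Nat.card A = q ^ (s + 1)) (hs1 : 1 ≤ s) (hsq : 2 ≤ s ∨ q ≠ 2) : False := by
  have := Fact.mk hq
  have hA : IsPGroup q A := IsPGroup.of_card hs
  obtain ⟨c, hc⟩ := exists_prime_orderOf_dvd_card' (G := A) q
    (hs ▸ dvd_pow_self q (Nat.succ_ne_zero s))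
  obtain ⟨χ, h1, h2⟩ := exists_endomorphism hq hs (Subgroup.zpowers c) (n := 1)
    (by rw [Nat.card_zpowers, hc, pow_one]) hs1 hc
  have hck : c ∈ χ.ker := h1 (Subgroup.mem_zpowers c)
  obtain ⟨hχ, hχq, hχ1⟩ := endomorphism_spec hq hc hck h2
  obtain ⟨g, hg, hgq⟩ := exists_transvection_pow_eq_one hG htors hq hA hj hmax hχ hχq hχ1
  have hcomm : ∀ a : χ.ker, Commute (j.comp χ.ker.subtype a) g := by
    intro a
    refine commute_iff_conj_eq.2 ((hg a).trans ?_)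
    rw [MonoidHom.mem_ker.1 a.2, mul_one]
    rfl
  have : NeZero q := ⟨hq.ne_zero⟩
  have : Finite (Multiplicative (ZMod q)) := inferInstanceAs (Finite (ZMod q))
  have hcard : Nat.card (χ.ker × Multiplicative (ZMod q)) = Nat.card A := by
    have h3 : Nat.card (Multiplicative (ZMod q)) = q := Nat.card_zmod q
    have h4 := χ.ker.card_mul_index
    rw [Subgroup.index_ker, h2, Nat.card_zpowers, hc] at h4
    rw [Nat.card_prod, h3, h4]
  have hinj : Function.Injective (adjoin (j.comp χ.ker.subtype) g q hgq hcomm) := by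
    rw [injective_iff_map_eq_one]
    rintro ⟨a, b⟩ hab
    obtain ⟨i, rfl, hi⟩ := exists_zmodHom_eq g q hgq b
    rw [adjoin, MonoidHom.noncommCoprod_apply] at hab
    simp only at hab
    rw [hi] at hab
    have h3 : g ^ i ∈ j.range := by
      rw [eq_inv_of_mul_eq_one_right hab]
      exact inv_mem (MonoidHom.mem_range.2 ⟨a, rfl⟩)
    obtain ⟨l, rfl⟩ := dvd_of_zpow_mem_range hq hj hχ hχq hχ1 hg h3
    rw [zpow_mul, zpow_natCast, hgq, one_zpow, mul_one] at hab
    have h4 : (a : A) = 1 := (injective_iff_map_eq_one j).1 hj _ hab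
    refine Prod.ext (Subtype.ext h4) ?_
    simp
  refine false_of_independent hG htors hq hinj (by rwa [hcard]) (hcard.trans hs) hs1 hsq
    (c := (⟨c, hck⟩, 1)) (d := (1, Multiplicative.ofAdd 1)) ?_ ?_ ?_
  · refine orderOf_eq_prime ?_ fun h => ?_
    · refine Prod.ext (Subtype.ext ?_) ?_
      · simp [← hc, pow_orderOf_eq_one]
      · simp
    · have h3 : c = 1 := congrArg Subtype.val (congrArg Prod.fst h)
      rw [h3, orderOf_one] at hc
      exact hq.ne_one hc.symm
  · refine orderOf_eq_prime ?_ fun h => ?_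
    · refine Prod.ext (by simp) ?_
      refine Multiplicative.toAdd.injective ?_
      simp
    · have h3 : (1 : ZMod q) = 0 := congrArg (fun p => p.2.toAdd) h
      exact one_ne_zero h3
  · rintro ⟨i, hi⟩
    have h3 := congrArg (fun p => p.2.toAdd) hi
    simp at h3

theorem isAbelianPSubgroup_zpowers {q k : ℕ} (hq : q.Prime) {z : G} (hz : orderOf z = q ^ k) :
    IsAbelianPSubgroup q (Subgroup.zpowers z) where
  comm := by
    rintro _ ⟨i, rfl⟩ _ ⟨l, rfl⟩
    exact zpow_mul_comm z i l
  finite := by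
    have : IsOfFinOrder z := orderOf_pos_iff.1 (hz ▸ pow_pos hq.pos k)
    exact this.finite_zpowers
  isPGroup := by
    have := Fact.mk hq
    exact IsPGroup.of_card ((Nat.card_zpowers z).trans hz)

open scoped IsMulCommutative in
-- Otherwise some abelian `q`-subgroup has maximal order, and `false_of_max` leaves only order `4`.
-- Then `⟨z⟩` is also maximal; for `χ(z) = z ^ 2`, the norm of `z` is `z ^ 4 = 1`, although `z` is
-- not a power of `z ^ 2`.
theorem exists_large_abelian (hG : InnerUltrahomogeneous G) (htors : ∀ g : G, IsOfFinOrder g)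
    {q : ℕ} (hq : q.Prime) {z : G} (hz : orderOf z = q ^ 2) (N : ℕ) :
    ∃ B : Subgroup G, IsAbelianPSubgroup q B ∧ N < Nat.card B := by
  by_contra! hbd
  have := Fact.mk hq
  have hzab := isAbelianPSubgroup_zpowers hq hz
  have hzcard : Nat.card (Subgroup.zpowers z) = q ^ 2 := (Nat.card_zpowers z).trans hz
  let S : Set ℕ := {n | ∃ B : Subgroup G, IsAbelianPSubgroup q B ∧ Nat.card B = n}
  have hSne : S.Nonempty := ⟨_, _, hzab, rfl⟩
  have hSbd : BddAbove S := ⟨N, by rintro _ ⟨B, hB, rfl⟩; exact hbd B hB⟩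
  obtain ⟨B, hB, hBcard⟩ := Nat.sSup_mem hSne hSbd
  have hmax : ∀ D : Subgroup G, IsAbelianPSubgroup q D → Nat.card D ≤ Nat.card B :=
    fun D hD => hBcard ▸ le_csSup hSbd ⟨D, hD, rfl⟩
  have := hB.finite
  have : IsMulCommutative B := ⟨⟨fun x y => Subtype.ext (hB.comm x x.2 y y.2)⟩⟩
  obtain ⟨n, hn⟩ := IsPGroup.iff_card.1 hB.isPGroup
  have hn2 : 2 ≤ n := by
    have := hmax _ hzab
    rw [hzcard, hn] at this
    exact (Nat.pow_le_pow_iff_right hq.one_lt).1 this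
  obtain ⟨s, rfl⟩ : ∃ s, n = s + 1 := ⟨n - 1, by omega⟩
  by_cases hcase : 2 ≤ s ∨ q ≠ 2
  · exact false_of_max hG htors hq B.subtype_injective hmax hn (by omega) hcase
  push Not at hcase
  obtain ⟨hs, rfl⟩ := hcase
  obtain rfl : s = 1 := by omega
  have hmax' : ∀ D : Subgroup G, IsAbelianPSubgroup 2 D →
      Nat.card D ≤ Nat.card (Subgroup.zpowers z) := by
    intro D hD
    rw [hzcard, ← hn]
    exact hmax D hD
  have := hzab.finite
  let z' : Subgroup.zpowers z := ⟨z, Subgroup.mem_zpowers z⟩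
  have hz' : orderOf z' = 2 ^ 2 := (Subgroup.orderOf_mk _ _).trans hz
  have hc : orderOf (z' ^ 2) = 2 := by
    rw [orderOf_pow, hz']; rfl
  obtain ⟨χ, h1, h2⟩ := exists_endomorphism hq (s := 1) hzcard (Subgroup.zpowers (z' ^ 2)) (n := 1)
    (by rw [Nat.card_zpowers, hc, pow_one]) le_rfl hc
  have hck := h1 (Subgroup.mem_zpowers (z' ^ 2))
  obtain ⟨hχ, hχq, hχ1⟩ := endomorphism_spec hq hc hck h2
  obtain ⟨g, k, hg, -⟩ := exists_transvection hG htors hq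
    (Subgroup.zpowers z).subtype_injective hχ hχq
  have hc2 : (z' ^ 2) ^ 2 = 1 := by
    have := pow_orderOf_eq_one (z' ^ 2)
    rwa [hc] at this
  have hgen : ∀ a : Subgroup.zpowers z, ∃ i : ℤ, a = z' ^ i := by
    rintro ⟨_, i, rfl⟩
    exact ⟨i, rfl⟩
  have hzz : χ z' = z' ^ 2 := by
    have hmem : χ z' ∈ χ.range := ⟨z', rfl⟩
    rw [h2] at hmem
    obtain ⟨i, hi⟩ := hmem
    have hi' : (z' ^ 2) ^ i = χ z' := hi
    rcases Int.even_or_odd' i with ⟨l, rfl | rfl⟩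
    · exfalso
      apply hχ1
      ext a
      obtain ⟨m, rfl⟩ := hgen a
      have h3 : χ z' = 1 := by
        rw [← hi', zpow_mul, zpow_ofNat, hc2, one_zpow]
      rw [map_zpow, h3, one_zpow, MonoidHom.one_apply]
    · rw [← hi', zpow_add, zpow_mul, zpow_ofNat, zpow_one, hc2, one_zpow, one_mul]
  have hmem := mem_range_of_norm_eq_one hG htors hq hzab.isPGroup
    (Subgroup.zpowers z).subtype_injective hmax' hχ hχq hχ1 hg (b := z') (by
      have h3 : ∑ i ∈ Finset.range 2, i = 1 := rfl
      rw [h3, pow_one, hzz, ← pow_two, hc2])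
  rw [h2] at hmem
  have h3 := orderOf_dvd_of_mem_zpowers hmem
  rw [hc, hz'] at h3
  norm_num at h3

/-- Any element outside the image of `E` enlarges the rank; if there is none, `A` has at most `q ^
m` elements. -/
theorem exists_freeModulo_or_card_le {A : Type*} [CommGroup A] [Finite A] {q : ℕ} (hq : q.Prime)
    (hA : ∀ a : A, a ^ q = 1) (m : ℕ) :
    (∃ E : Multiplicative (Fin m → ℤ) →* A, FreeModulo q E) ∨ Nat.card A ≤ q ^ m := by
  induction m with
  | zero => exact Or.inl ⟨_, freeModulo_fin_zero q⟩
  | succ m ih =>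
    rcases ih with ⟨E, hE⟩ | h
    · by_cases hsurj : Function.Surjective E
      · right
        have hs : Function.Surjective fun v : Fin m → Fin q =>
            E (Multiplicative.ofAdd fun i => ((v i : ℕ) : ℤ)) := by
          intro a
          obtain ⟨w, rfl⟩ := hsurj a
          have hq0 : (0 : ℤ) < q := by exact_mod_cast hq.pos
          have h0 : ∀ i, ((w.toAdd i % q).toNat : ℤ) = w.toAdd i % q :=
            fun i => Int.toNat_of_nonneg (Int.emod_nonneg _ hq0.ne')
          refine ⟨fun i => ⟨(w.toAdd i % q).toNat, ?_⟩, ?_⟩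
          · have := Int.emod_lt_of_pos (w.toAdd i) hq0
            have := h0 i
            omega
          · change _ = E (Multiplicative.ofAdd w.toAdd)
            rw [hE.eq_iff]
            intro i
            simp only [h0]
            exact (Int.mod_modEq _ _).symm.dvd
        have := Nat.card_le_card_of_surjective _ hs
        rw [Nat.card_fun, Nat.card_fin, Nat.card_fin] at this
        exact this.trans (Nat.pow_le_pow_right hq.pos (Nat.le_succ m))
      · left
        obtain ⟨x, hx⟩ := not_forall.1 hsurj
        refine ⟨_, hE.extend (t := x) (fun v => Commute.all _ _) (hA x) fun n v hn => ?_⟩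
        by_contra hnd
        -- If `q` did not divide `n`, Bézout would make `x` a power of `x ^ n`, hence a value of
        -- `E`.
        obtain ⟨u, w, huw⟩ := (Prime.coprime_iff_not_dvd (Nat.prime_iff_prime_int.1 hq)).2 hnd
        apply hx
        refine ⟨v ^ w, ?_⟩
        rw [map_zpow, ← hn, ← zpow_mul, mul_comm n w, ← eq_sub_iff_add_eq'.2 huw |>.symm, zpow_sub,
          zpow_one, mul_comm u, zpow_mul, zpow_natCast, hA, one_zpow, inv_one, mul_one]
    · exact Or.inr (h.trans (Nat.pow_le_pow_right hq.pos (Nat.le_succ m)))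

/-- Induct along `a ↦ a ^ q`: its kernel has at most `q ^ R` elements, and its image has smaller
exponent. -/
theorem card_le_of_not_freeModulo {q : ℕ} (hq : q.Prime) {R : ℕ}
    (hR : ¬ ∃ E : Multiplicative (Fin R → ℤ) →* G, FreeModulo q E) (n : ℕ) :
    ∀ (A : Type*) [CommGroup A] [Finite A] (j : A →* G), Function.Injective j →
      (∀ a : A, a ^ q ^ n = 1) → Nat.card A ≤ (q ^ R) ^ n := by
  induction n with
  | zero =>
    intro A _ _ j _ hA
    have : Subsingleton A := ⟨fun a b => by
      have h1 := hA a
      have h2 := hA b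
      rw [pow_zero, pow_one] at h1 h2
      rw [h1, h2]⟩
    rw [pow_zero]
    exact Finite.card_le_one_iff_subsingleton.2 this
  | succ n ih =>
    intro A _ _ j hj hA
    have h1 := ih (powMonoidHom q : A →* A).range
      (j.comp (powMonoidHom q : A →* A).range.subtype)
      (hj.comp (Subgroup.subtype_injective _)) (by
        rintro ⟨_, a, rfl⟩
        refine Subtype.ext ?_
        change (a ^ q) ^ q ^ n = 1
        rw [← pow_mul, ← pow_succ']
        exact hA a)
    have h2 : Nat.card (powMonoidHom q : A →* A).ker ≤ q ^ R := by
      refine (exists_freeModulo_or_card_le hq (A := (powMonoidHom q : A →* A).ker) ?_ R).resolve_left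
        ?_
      · rintro ⟨a, ha⟩
        exact Subtype.ext ha
      · rintro ⟨E, hE⟩
        refine hR ⟨(j.comp (Subgroup.subtype _)).comp E, fun v => ?_⟩
        rw [← hE v]
        exact map_eq_one_iff (j.comp (Subgroup.subtype _))
          (hj.comp (Subgroup.subtype_injective _))
    have h3 := (powMonoidHom q : A →* A).ker.card_mul_index
    rw [Subgroup.index_ker] at h3
    rw [← h3, pow_succ']
    exact Nat.mul_le_mul h2 h1

/-- A conjugator that shifts `q ^ n` basis elements cyclically has order divisible by `q ^ n`. -/
theorem exists_orderOf_of_freeModulo (hG : InnerUltrahomogeneous G)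
    (htors : ∀ g : G, IsOfFinOrder g) {q n : ℕ} (hq : q.Prime)
    {E : Multiplicative (Fin (q ^ n) → ℤ) →* G} (hE : FreeModulo q E) :
    ∃ a : G, orderOf a = q ^ n := by
  have : NeZero (q ^ n) := ⟨pow_ne_zero _ hq.ne_zero⟩
  obtain ⟨F, hF⟩ := hE.comp_equiv (Fintype.equivFinOfCardEq (ZMod.card (q ^ n)))
  obtain ⟨g, hg⟩ := hF.exists_conj_perm hG (Equiv.addRight (1 : ZMod (q ^ n)))
  have hpow : ∀ k : ℕ, (g ^ k)⁻¹ * F (Multiplicative.ofAdd (Pi.single 0 1)) * g ^ k =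
      F (Multiplicative.ofAdd (Pi.single (k : ZMod (q ^ n)) 1)) := by
    intro k
    induction k with
    | zero => simp
    | succ k ih =>
      have : (g ^ (k + 1))⁻¹ * F (Multiplicative.ofAdd (Pi.single 0 1)) * g ^ (k + 1) =
        g⁻¹ * ((g ^ k)⁻¹ * F (Multiplicative.ofAdd (Pi.single 0 1)) * g ^ k) * g := by
        rw [pow_succ]; group
      rw [this, ih, hg]
      simp
  have h1 := hpow (orderOf g)
  rw [pow_orderOf_eq_one, inv_one, one_mul, mul_one, hF.eq_iff] at h1
  have h2 : ((orderOf g : ℕ) : ZMod (q ^ n)) = 0 := by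
    by_contra hne
    have := h1 0
    rw [Pi.single_eq_same, Pi.single_eq_of_ne (Ne.symm hne), sub_zero] at this
    exact (Nat.prime_iff_prime_int.1 hq).not_isUnit (isUnit_of_dvd_one this)
  rw [ZMod.natCast_eq_zero_iff] at h2
  exact ⟨_, orderOf_pow_orderOf_div (htors g).orderOf_pos.ne' h2⟩

open scoped IsMulCommutative in
/-- In a torsion inner ultrahomogeneous group with an element of order `q ^ 2`, the orders of the
`q`-elements are unbounded. -/
theorem exists_orderOf_pow (hG : InnerUltrahomogeneous G)
    (htors : ∀ g : G, IsOfFinOrder g) {q : ℕ} (hq : q.Prime) {z : G} (hz : orderOf z = q ^ 2)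
    (n : ℕ) : ∃ a : G, orderOf a = q ^ n := by
  by_contra hn
  have hR : ¬ ∃ E : Multiplicative (Fin (q ^ n) → ℤ) →* G, FreeModulo q E :=
    fun ⟨E, hE⟩ => hn (exists_orderOf_of_freeModulo hG htors hq hE)
  obtain ⟨B, hB, hlt⟩ := exists_large_abelian hG htors hq hz ((q ^ q ^ n) ^ n)
  have := hB.finite
  have : IsMulCommutative B := ⟨⟨fun x y => Subtype.ext (hB.comm x x.2 y y.2)⟩⟩
  -- `B` is killed by `q ^ n`, since an element of larger order in `B` would have a power of order
  -- exactly `q ^ n`.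
  refine hlt.not_ge (card_le_of_not_freeModulo hq hR n B B.subtype B.subtype_injective fun a => ?_)
  obtain ⟨k, hk⟩ := hB.isPGroup a
  obtain ⟨m, -, hm⟩ := (Nat.dvd_prime_pow hq).1 (orderOf_dvd_of_pow_eq_one hk)
  rw [← orderOf_dvd_iff_pow_eq_one, hm]
  refine pow_dvd_pow q ?_
  by_contra! hlt'
  refine hn ⟨_, orderOf_pow_orderOf_div (x := (a : G)) (htors _).orderOf_pos.ne' ?_⟩
  rw [Subgroup.orderOf_coe, hm]
  exact pow_dvd_pow q hlt'.le

/-! ### The number `1806` and elements of order `q ^ 2` -/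

theorem dvd_1806_of_squarefree {n : ℕ} (hn : Squarefree n)
    (h : ∀ r, r.Prime → r ∣ n → r ∣ 1806) : n ∣ 1806 := by
  rw [← Nat.prod_primeFactors_of_squarefree hn]
  refine (Finset.prod_dvd_prod_of_subset _ (Nat.primeFactors 1806) _ fun r hr => ?_).trans
    (Nat.prod_primeFactors_dvd 1806)
  have hr' := Nat.mem_primeFactors.1 hr
  exact Nat.mem_primeFactors.2 ⟨hr'.1, h r hr'.1 hr'.2.1, by norm_num⟩

/-- `1806 = 2 · 3 · 7 · 43`, and the only primes of the form `d + 1` with `d` dividing it are these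
four. -/
theorem succ_dvd_1806 {d : ℕ} (hd : d ∣ 1806) (hp : (d + 1).Prime) : d + 1 ∣ 1806 := by
  have hmem : d ∈ Nat.divisors 1806 := Nat.mem_divisors.2 ⟨hd, by norm_num⟩
  have hdiv : Nat.divisors 1806 =
      {1, 2, 3, 6, 7, 14, 21, 42, 43, 86, 129, 258, 301, 602, 903, 1806} := by decide +kernel
  rw [hdiv] at hmem
  simp only [Finset.mem_insert, Finset.mem_singleton] at hmem
  rcases hmem with rfl | rfl | rfl | rfl | rfl | rfl | rfl | rfl | rfl | rfl | rfl | rfl | rfl |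
    rfl | rfl | rfl <;> revert hp <;> norm_num

/-- Conjugation can induce on `⟨a⟩` multiplication by a primitive root modulo `p`, an automorphism
of order `p - 1`. -/
theorem sub_one_dvd_orderOf (hG : InnerUltrahomogeneous G) {p : ℕ} (hp : p.Prime) {a : G}
    (ha : orderOf a = p) : ∃ t : G, p - 1 ∣ orderOf t := by
  have := Fact.mk hp
  obtain ⟨E, hE⟩ := exists_freeModulo_one ha
  obtain ⟨u, hu⟩ := IsCyclic.exists_generator (α := (ZMod p)ˣ)
  set k : ℤ := (((u : ZMod p).val : ℕ) : ℤ) with hk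
  have hku : (k : ZMod p) = u := by simp [hk]
  obtain ⟨t, ht⟩ := hE.exists_conj_diag hG (fun _ => k) (fun _ => by
    have := ZMod.val_coe_unit_coprime u
    exact Nat.isCoprime_iff_coprime.2 this)
  refine ⟨t, ?_⟩
  have h1 := conj_pow_of_conj_smul (d := k) (E := E) ht (orderOf t) (Pi.single 0 1)
  rw [pow_orderOf_eq_one, inv_one, one_mul, mul_one, hE.eq_iff] at h1
  have h2 := h1 0
  simp only [Pi.smul_apply, Pi.single_eq_same, smul_eq_mul, mul_one] at h2
  have h3 : u ^ orderOf t = 1 := by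
    ext
    have h5 := (ZMod.intCast_zmod_eq_zero_iff_dvd _ p).2 h2
    push_cast at h5
    rw [hku, sub_eq_zero] at h5
    exact h5.symm
  have h4 : orderOf u = p - 1 := by
    rw [orderOf_eq_card_of_forall_mem_zpowers hu, Nat.card_eq_fintype_card, ZMod.card_units]
  rw [← h4]
  exact orderOf_dvd_of_pow_eq_one h3

theorem exists_orderOf_eq_of_dvd {t : G} (ht : IsOfFinOrder t) {d : ℕ} (hd : d ∣ orderOf t) :
    ∃ a : G, orderOf a = d := ⟨_, orderOf_pow_orderOf_div ht.orderOf_pos.ne' hd⟩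

/-- A torsion inner ultrahomogeneous group of infinite exponent has an element of order `q ^ 2` for
some prime `q`. -/
theorem exists_orderOf_sq (hG : InnerUltrahomogeneous G) (htors : ∀ g : G, IsOfFinOrder g)
    (hexp : ¬ Monoid.ExponentExists G) : ∃ (q : ℕ) (z : G), q.Prime ∧ orderOf z = q ^ 2 := by
  by_contra! hno
  have hsq : ∀ (t : G) (d : ℕ), d ∣ orderOf t → Squarefree d := by
    intro t d hd
    rw [Nat.squarefree_iff_prime_squarefree]
    intro r hr hrd
    obtain ⟨a, ha⟩ := exists_orderOf_eq_of_dvd (htors t) (hrd.trans hd)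
    exact hno r a hr (by rw [ha, pow_two])
  have hprime : ∀ p : ℕ, p.Prime → (∃ a : G, orderOf a = p) → p ∣ 1806 := by
    intro p
    induction p using Nat.strong_induction_on with
    | _ p ih =>
      rintro hp ⟨a, ha⟩
      obtain ⟨t, ht⟩ := sub_one_dvd_orderOf hG hp ha
      have hp1 : p - 1 + 1 = p := Nat.sub_add_cancel hp.one_le
      -- The prime factors of the squarefree number `p - 1` are smaller than `p` and are themselves
      -- orders of elements.
      have h1 : p - 1 ∣ 1806 := dvd_1806_of_squarefree (hsq t _ ht) fun r hr hrp =>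
        ih r (by
          have := Nat.le_of_dvd (by have := hp.two_le; omega) hrp
          omega) hr (exists_orderOf_eq_of_dvd (htors t) (hrp.trans ht))
      have := succ_dvd_1806 h1 (by rwa [hp1])
      rwa [hp1] at this
  refine hexp ⟨1806, by norm_num, fun g => ?_⟩
  rw [← orderOf_dvd_iff_pow_eq_one]
  exact dvd_1806_of_squarefree (hsq g _ dvd_rfl) fun r hr hrg =>
    hprime r hr (exists_orderOf_eq_of_dvd (htors g) hrg)

theorem hasLargeFree_and_hasCentralizerChains (hG : InnerUltrahomogeneous G)
    (hexp : ¬ Monoid.ExponentExists G) : HasLargeFree G ∧ HasCentralizerChains G := by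
  by_cases htors : ∀ g : G, IsOfFinOrder g
  · obtain ⟨q, z, hq, hz⟩ := exists_orderOf_sq hG htors hexp
    have h := exists_orderOf_pow hG htors hq hz
    exact ⟨hasLargeFree_of_torsion hG htors hq.one_lt h,
      hasCentralizerChains_of_torsion hG htors hq.one_lt h⟩
  · push Not at htors
    obtain ⟨a, ha⟩ := htors
    exact ⟨hasLargeFree_of_not_torsion hG ha, hasCentralizerChains_of_not_torsion hG ha⟩

end Untame

theorem mainTheorem2 {Γ : Type*} [Group Γ] (hΓ : Untame.InnerUltrahomogeneous Γ)
    (hexp : ¬ Monoid.ExponentExists Γ) :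
    (Untame.HasIP Γ Untame.commXY ∧ Untame.HasOP Γ Untame.commXY) ∧
    (∀ n : ℕ, Untame.HasIPn n Γ (Untame.conjProdComm n)) ∧
    Untame.HasSOP Γ Untame.centralizerLe ∧
    Untame.HasTP2 Γ Untame.centralizerDiff := by
  obtain ⟨hfree, hchain⟩ := Untame.hasLargeFree_and_hasCentralizerChains hΓ hexp
  have hIP := hfree.hasIP hΓ
  exact ⟨⟨hIP, hIP.hasOP⟩, hfree.hasIPn hΓ, hchain.hasSOP, hchain.hasTP2⟩
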